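/- Let $J$ be a finite set of services, partitioned into groups $J_i$, one for each agent $i$ of a finite set $N$ (a group may be empty), and let $\mathcal J\subseteq 2^J$ be a nonempty, downward closed set system with $|S\cap J_i|\le 1$ for all $S\in\mathcal J$ and $i\in N$. For each $j\in J_i$ the value $v_j\ge 0$ of agent $i$ for service $j$ is drawn, independently of all other values, from a distribution $F_j$ on $[0,\infty)$ that has a density and satisfies $p\,(1-F_j(p))\to 0$ as $p\to\infty$ (which holds whenever $F_j$ has finite mean). These data form an instance $\mathcal I$ of the Bayesian multi-parameter unit-demand mechanism design problem (BMUMD). A deterministic mechanism $\mathcal A=(M,\pi)$ for $\mathcal I$ maps (measurably) every bid vector $v\in[0,\infty)^J$ to an allocation $M(v)\in\mathcal J$ and payments $\pi_i(v)\in\mathbb R$, $i\in N$. It is individually rational if $\pi_i(v)\le v_j$ whenever $j\in M(v)\cap J_i$, and $\pi_i(v)=0$ whenever $M(v)\cap J_i=\emptyset$. It is truthful if for all $i$ and all $v,w\in[0,\infty)^J$ with $w_j=v_j$ for $j\notin J_i$, $$\sum_{j\in M(w)\cap J_i}v_j-\pi_i(w)\;\le\;\sum_{j\in M(v)\cap J_i}v_j-\pi_i(v).$$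 Its expected revenue is $\mathcal R^{\mathcal A}=\mathbb E_v\big[\sum_{i\in N}\pi_i(v)\big]$. The instance with copies $\mathcal I^{\mathrm{copies}}$ is the single-parameter instance whose agents are the elements of $J$, where agent $j$ has value $v_j\sim F_j$ for being served, independently of the others, and the sets of agents that may be served together are those in $\mathcal J$. Myerson's mechanism for it is the following. Let $\bar R_j$ be the upper concave envelope on $[0,1]$ of the revenue curve formed by the points $\big(1-F_j(p),\,p\,(1-F_j(p))\big)$, $p\ge 0$. The ironed virtual value $\bar\phi_j(v_j)$ is the right derivative of $\bar R_j$ at $q=1-F_j(v_j)$ if $q<1$, and $-\infty$ if $q=1$. The mechanism serves a set $S\in\mathcal J$ that maximizes $\sum_{j\in S}\bar\phi_j(v_j)$, chosen by a fixed, arbitrary rule that depends only on the collection of maximizing sets. Each served agent pays the infimum of the nonnegative bids with which she would be served, given the bids of the others; agents who are not served pay nothing. Claim: for every individually rational, truthful, deterministic mechanism $\mathcal A$ for $\mathcal I$ and every such tie-breaking rule, the revenue of Myerson's mechanism on $\mathcal I^{\mathrm{copies}}$ is integrable, the positive part of the revenue of $\mathcal A$ has finite expectation, and the expected revenue $\mathcal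 R^{\mathcal A}$ is at most the expected revenue of Myerson's mechanism on $\mathcal I^{\mathrm{copies}}$. -/

import Mathlib

open MeasureTheory Filter Topology

/-- A Bayesian single-parameter instance with agents `J`: agent `j`'s value is drawn, independently
of the others, from `dist j`, a probability distribution on `[0, ∞)` with a density; the sets of
agents that can be served simultaneously form a nonempty downward closed set system. -/
structure BSMD (J : Type*) where
  dist : J → Measure ℝ
  isProbabilityMeasure : ∀ j, IsProbabilityMeasure (dist j)
  hasDensity : ∀ j, dist j ≪ volume
  nonneg : ∀ j, dist j (Set.Iio 0) = 0
  feasible : Set (Finset J)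
  empty_feasible : ∅ ∈ feasible
  downwardClosed : ∀ S ∈ feasible, ∀ T ⊆ S, T ∈ feasible

/-- A Bayesian multi-parameter unit-demand instance with agents `N` and services `J`. The group
`J_i` of services targeted at agent `i` is `{j | owner j = i}`; the value of agent `owner j` for
service `j` is drawn, independently of all other values, from `dist j`. A feasible set contains at
most one service for each agent. -/
structure BMUMD (J N : Type*) where
  owner : J → N
  dist : J → Measure ℝ
  isProbabilityMeasure : ∀ j, IsProbabilityMeasure (dist j)
  hasDensity : ∀ j, dist j ≪ volume
  nonneg : ∀ j, dist j (Set.Iio 0) = 0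
  feasible : Set (Finset J)
  empty_feasible : ∅ ∈ feasible
  downwardClosed : ∀ S ∈ feasible, ∀ T ⊆ S, T ∈ feasible
  unitDemand : ∀ S ∈ feasible, ∀ j ∈ S, ∀ k ∈ S, owner j = owner k → j = k

/-- The instance with copies: every service becomes a separate single-parameter agent. -/
def BMUMD.copies {J N : Type*} (I : BMUMD J N) : BSMD J where
  dist := I.dist
  isProbabilityMeasure := I.isProbabilityMeasure
  hasDensity := I.hasDensity
  nonneg := I.nonneg
  feasible := I.feasible
  empty_feasible := I.empty_feasible
  downwardClosed := I.downwardClosed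

/-- A deterministic direct mechanism: it maps each vector of bids, one for each element of `J`, to
the set of elements of `J` that are allocated and to a payment for each agent in `N`. -/
structure Mechanism (J N : Type*) where
  alloc : (J → ℝ) → Finset J
  pay : (J → ℝ) → N → ℝ

namespace Mechanism

variable {J N : Type*}

/-- Total payment collected at the bid vector `v`. -/
def revenue [Fintype N] (A : Mechanism J N) (v : J → ℝ) : ℝ := ∑ i, A.pay v i

/-- The utility of agent `i` with true values `v` when the bids are `w`. (For a feasible mechanism
the sum has at most one term.) -/
def utility [DecidableEq N] (A : Mechanism J N) (I : BMUMD J N) (i : N) (v w : J → ℝ) : ℝ :=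
  (∑ j ∈ A.alloc w with I.owner j = i, v j) - A.pay w i

/-- The mechanism always picks a feasible allocation. -/
def IsFeasible (A : Mechanism J N) (I : BMUMD J N) : Prop :=
  ∀ v : J → ℝ, 0 ≤ v → A.alloc v ∈ I.feasible

/-- An agent who is allocated a service pays at most her value for it; an agent who is allocated
nothing pays nothing. -/
def IsIndividuallyRational (A : Mechanism J N) (I : BMUMD J N) : Prop :=
  ∀ v : J → ℝ, 0 ≤ v → ∀ i,
    (∀ j ∈ A.alloc v, I.owner j = i → A.pay v i ≤ v j) ∧
    ((∀ j ∈ A.alloc v, I.owner j ≠ i) → A.pay v i = 0)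

/-- Bidding the true values is a dominant strategy for every agent: `w` ranges over all bid vectors
that differ from `v` only in the bids of agent `i`. -/
def IsTruthful [DecidableEq N] (A : Mechanism J N) (I : BMUMD J N) : Prop :=
  ∀ (i : N) (v w : J → ℝ), 0 ≤ v → 0 ≤ w → (∀ j, I.owner j ≠ i → w j = v j) →
    A.utility I i v w ≤ A.utility I i v v

/-- The allocation and the payments are measurable functions of the bids. -/
def IsMeasurable (A : Mechanism J N) : Prop :=
  (∀ j, MeasurableSet {v : J → ℝ | j ∈ A.alloc v}) ∧ ∀ i, Measurable fun v => A.pay v i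

end Mechanism

/-- The probability `1 - F(p)` of selling at price `p` to an agent with value distribution `μ`. -/
noncomputable def saleProb (μ : Measure ℝ) (p : ℝ) : ℝ := μ.real (Set.Ici p)

/-- The ironed revenue curve, as a function of the sale probability `q`: the upper concave envelope
(infimum of affine majorants) of the revenue curve, which consists of the points
`(1 - F(p), p (1 - F(p)))` for prices `p ≥ 0`. -/
noncomputable def ironedRevenue (μ : Measure ℝ) (q : ℝ) : ℝ :=
  sInf {y | ∃ a b : ℝ,
    (∀ p, 0 ≤ p → p * saleProb μ p ≤ a + b * saleProb μ p) ∧ y = a + b * q}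

open Classical in
/-- The ironed virtual value of `v`: the slope of the ironed revenue curve at `q = 1 - F(v)`.
(The slope of the revenue curve itself is the virtual value `v - (1 - F(v)) / f(v)`.) The slope is
taken from the right, the curve being `-∞` outside `[0, 1]`; so the value is `-∞` if `F(v) = 0`. -/
noncomputable def ironedVirtualValue (μ : Measure ℝ) (v : ℝ) : EReal :=
  if saleProb μ v < 1 then
    ((derivWithin (ironedRevenue μ) (Set.Ioi (saleProb μ v)) (saleProb μ v) : ℝ) : EReal)
  else ⊥

namespace BSMD

variable {J : Type*}

/-- The ironed virtual surplus of the set `S` at the value vector `v`. -/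
noncomputable def ironedSurplus (I : BSMD J) (v : J → ℝ) (S : Finset J) : EReal :=
  ∑ j ∈ S, ironedVirtualValue (I.dist j) (v j)

/-- The feasible sets of maximum ironed virtual surplus. -/
def maximizers (I : BSMD J) (v : J → ℝ) : Set (Finset J) :=
  {S | S ∈ I.feasible ∧ ∀ T ∈ I.feasible, I.ironedSurplus v T ≤ I.ironedSurplus v S}

theorem maximizers_nonempty [Finite J] (I : BSMD J) (v : J → ℝ) : (I.maximizers v).Nonempty := by
  obtain ⟨S, hS, h⟩ := Set.exists_max_image I.feasible (I.ironedSurplus v)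
    (Set.toFinite _) ⟨∅, I.empty_feasible⟩
  exact ⟨S, hS, h⟩

/-- Myerson's mechanism: it serves a feasible set of maximum ironed virtual surplus, chosen among
these sets by the tie-breaking rule `tie`. An agent who is served pays the least bid with which she
would be served, given the bids of the others; the other agents pay nothing. -/
noncomputable def myerson [DecidableEq J] (I : BSMD J) (tie : Set (Finset J) → Finset J) :
    Mechanism J J where
  alloc v := tie (I.maximizers v)
  pay v j :=
    if j ∈ tie (I.maximizers v) then
      sInf {z : ℝ | 0 ≤ z ∧ j ∈ tie (I.maximizers (Function.update v j z))}
    else 0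

end BSMD

/-! The proof bounds the revenue of both mechanisms by virtual surplus, one service at a time. Fix a
service `j` and all other bids, and let `W` be the set of bids on `j` that win it; in both
mechanisms `W` is an upper set. Truthfulness and individual rationality applied to deviations in
coordinate `j` alone show that the payment for `j` in `A` is at most `sInf W` (`pay_update_le`,
`mem_alloc_update_mono`), so no other feature of the unit-demand agent matters. In Myerson's
mechanism it is exactly `sInf W`.

The posted price `t = sInf W` earns `t (1 - F(t))`, a point of the revenue curve, hence at most
`R̄(s)` at `s = 1 - F(t)`. Since `R̄(0) = 0` and `1 - F(v)` is uniform on `(0, 1)`, `R̄(s)` is at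
most the integral over `W` of the positive part of the ironed virtual value (`sInf_mul_measure_le`).
For Myerson's mechanism this is an equality (`lintegral_le_sInf_mul_measure`): virtual values are
nonnegative on `W`, and `W` is a union of level sets of the ironed virtual value, so its lower end
cannot lie inside an ironed interval and the curve meets its envelope there
(`ironedRevenue_saleProb_sInf_le`).

It remains to compare virtual surpluses pointwise: the allocation of `A` is feasible for the copies,
and Myerson's set is optimal even against sums of positive parts (`sum_ironedVirtualValue_le`).
Working with positive parts in `ENNReal` matters because negative parts of virtual values need not
be integrable. -/

/-! ### Sale probabilities: continuity and uniform distribution. -/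

section SaleProb

variable {μ : Measure ℝ} [IsProbabilityMeasure μ]

theorem saleProb_antitone : Antitone (saleProb μ) :=
  fun _ _ h => measureReal_mono (Set.Ici_subset_Ici.2 h)

theorem saleProb_nonneg {μ : Measure ℝ} (p : ℝ) : 0 ≤ saleProb μ p := measureReal_nonneg

theorem saleProb_le_one (p : ℝ) : saleProb μ p ≤ 1 := measureReal_le_one

theorem ofReal_saleProb (p : ℝ) : ENNReal.ofReal (saleProb μ p) = μ (Set.Ici p) :=
  ofReal_measureReal

theorem saleProb_of_nonpos (h0 : μ (Set.Iio 0) = 0) {p : ℝ} (hp : p ≤ 0) : saleProb μ p = 1 := by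
  have h : μ (Set.Iio p) = 0 := measure_mono_null (Set.Iio_subset_Iio hp) h0
  rw [saleProb, ← Set.compl_Iio, measureReal_compl measurableSet_Iio,
    measureReal_def μ (Set.Iio p), h]
  simp

theorem saleProb_eq_one_sub_cdf [NullSingletonClass μ] (p : ℝ) :
    saleProb μ p = 1 - ProbabilityTheory.cdf μ p := by
  rw [ProbabilityTheory.cdf_eq_real, saleProb, measureReal_congr Ioi_ae_eq_Ici.symm,
    ← Set.compl_Iic, measureReal_compl measurableSet_Iic]
  simp

theorem continuous_saleProb [NullSingletonClass μ] : Continuous (saleProb μ) := by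
  have h : Continuous (ProbabilityTheory.cdf μ) := by
    refine continuous_iff_continuousAt.2 fun x => ?_
    have hm := (ProbabilityTheory.cdf μ).mono
    rw [hm.continuousAt_iff_leftLim_eq_rightLim, StieltjesFunction.rightLim_eq]
    refine le_antisymm (hm.leftLim_le le_rfl) ?_
    have h1 : (ProbabilityTheory.cdf μ).measure {x} = 0 := by
      rw [ProbabilityTheory.measure_cdf]; exact measure_singleton x
    rw [StieltjesFunction.measure_singleton, ENNReal.ofReal_eq_zero] at h1
    linarith
  rw [show saleProb μ = fun p => 1 - ProbabilityTheory.cdf μ p from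
    funext saleProb_eq_one_sub_cdf]
  exact continuous_const.sub h

theorem tendsto_saleProb_atTop [NullSingletonClass μ] : Tendsto (saleProb μ) atTop (𝓝 0) := by
  rw [show saleProb μ = fun p => 1 - ProbabilityTheory.cdf μ p from
    funext saleProb_eq_one_sub_cdf]
  simpa using (tendsto_const_nhds (x := (1 : ℝ))).sub (ProbabilityTheory.tendsto_cdf_atTop μ)

/-- Every number strictly between `0` and the sale probability at `t` is the sale probability at a
larger price. -/
theorem exists_saleProb_eq_of_lt [NullSingletonClass μ] {t x : ℝ} (hx : 0 < x)
    (hxt : x < saleProb μ t) :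
    ∃ z, t < z ∧ saleProb μ z = x := by
  obtain ⟨p, hp, hpt⟩ := ((tendsto_saleProb_atTop (μ := μ)).eventually (gt_mem_nhds hx)).and
    (eventually_ge_atTop t) |>.exists
  obtain ⟨z, hz, rfl⟩ := intermediate_value_Icc' hpt (continuous_saleProb (μ := μ)).continuousOn
    (show x ∈ Set.Icc _ _ from ⟨hp.le, hxt.le⟩)
  refine ⟨z, lt_of_le_of_ne hz.1 ?_, rfl⟩
  rintro rfl
  exact lt_irrefl _ hxt

/-- The sale probability at a random value is uniformly distributed. -/
theorem map_saleProb [NullSingletonClass μ] (h0 : μ (Set.Iio 0) = 0) :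
    μ.map (saleProb μ) = volume.restrict (Set.Ioo 0 1) := by
  have hc := continuous_saleProb (μ := μ)
  have : IsProbabilityMeasure (μ.map (saleProb μ)) :=
    Measure.isProbabilityMeasure_map hc.measurable.aemeasurable
  refine Measure.ext_of_Iic _ _ fun x => ?_
  rw [Measure.map_apply hc.measurable measurableSet_Iic, Measure.restrict_apply measurableSet_Iic]
  rcases le_or_gt 1 x with hx1 | hx1
  · have h1 : saleProb μ ⁻¹' Set.Iic x = Set.univ :=
      Set.eq_univ_of_forall fun z => (saleProb_le_one z).trans hx1
    have h2 : Set.Iic x ∩ Set.Ioo 0 1 = Set.Ioo 0 1 :=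
      Set.inter_eq_right.2 fun z hz => hz.2.le.trans hx1
    rw [h1, h2]; simp
  -- By continuity and monotonicity the sublevel set is a closed half-line whose endpoint has sale
  -- probability exactly `x`.
  have key : ∀ x : ℝ, 0 < x → x < 1 → μ (saleProb μ ⁻¹' Set.Iic x) = ENNReal.ofReal x := by
    intro x hx hx1
    obtain ⟨z, hz, hzx⟩ := exists_saleProb_eq_of_lt (μ := μ) (t := 0) hx
      (by rwa [saleProb_of_nonpos h0 le_rfl])
    set A := saleProb μ ⁻¹' Set.Iic x with hA
    have hcl : IsClosed A := isClosed_Iic.preimage hc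
    have hbdd : BddBelow A := by
      refine ⟨0, fun y hy => ?_⟩
      by_contra! hy0
      have : saleProb μ y ≤ x := hy
      rw [saleProb_of_nonpos h0 hy0.le] at this
      linarith
    have hmem : sInf A ∈ A := hcl.csInf_mem ⟨z, hzx.le⟩ hbdd
    have hAI : A = Set.Ici (sInf A) := by
      refine Set.Subset.antisymm (fun y hy => csInf_le hbdd hy) fun y hy => ?_
      exact (saleProb_antitone hy).trans hmem
    have hval : saleProb μ (sInf A) = x := by
      refine le_antisymm hmem ?_
      rw [← hzx]
      exact saleProb_antitone (csInf_le hbdd (show z ∈ A from hzx.le))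
    rw [hAI, ← ofReal_saleProb, hval]
  rcases lt_or_ge 0 x with hx | hx
  · have h2 : Set.Iic x ∩ Set.Ioo 0 1 = Set.Ioc 0 x := by
      ext y; simp only [Set.mem_inter_iff, Set.mem_Iic, Set.mem_Ioo, Set.mem_Ioc]
      constructor
      · rintro ⟨a, b, _⟩; exact ⟨b, a⟩
      · rintro ⟨a, b⟩; exact ⟨b, a, b.trans_lt hx1⟩
    rw [key x hx hx1, h2]; simp
  · have h2 : Set.Iic x ∩ Set.Ioo 0 1 = ∅ := by
      ext y; simp only [Set.mem_inter_iff, Set.mem_Iic, Set.mem_Ioo, Set.mem_empty_iff_false]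
      constructor
      · rintro ⟨a, b, _⟩; linarith
      · simp
    rw [h2, measure_empty]
    refine le_antisymm (le_of_forall_gt_imp_ge_of_dense fun ε hε => ?_) zero_le
    obtain ⟨r, hr, hrε⟩ := ENNReal.lt_iff_exists_nnreal_btwn.1 hε
    have hr0 : 0 < r := by exact_mod_cast hr
    have hm : (0 : ℝ) < min r 2⁻¹ := lt_min hr0 (by norm_num)
    calc μ (saleProb μ ⁻¹' Set.Iic x) ≤ μ (saleProb μ ⁻¹' Set.Iic (min (r : ℝ) 2⁻¹)) :=
          measure_mono fun y hy => le_trans hy (hx.trans hm.le)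
      _ = ENNReal.ofReal (min (r : ℝ) 2⁻¹) :=
          key _ hm ((min_le_right _ _).trans_lt (by norm_num))
      _ ≤ ENNReal.ofReal r := ENNReal.ofReal_le_ofReal (min_le_left _ _)
      _ ≤ ε := by simpa using hrε.le

/-- Change of variables from values to sale probabilities. -/
theorem setLIntegral_comp_saleProb [NullSingletonClass μ] (h0 : μ (Set.Iio 0) = 0)
    {f : ℝ → ENNReal} (hf : Measurable f) (t : ℝ) :
    ∫⁻ v in Set.Ici t, f (saleProb μ v) ∂μ = ∫⁻ x in Set.Ioo 0 (saleProb μ t), f x := by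
  have hm := (continuous_saleProb (μ := μ)).measurable
  -- The half-line above `t` and the event that the sale probability is at most that of `t` differ
  -- only inside this level set, which is null because the uniform law has no atoms.
  have hlevel : μ (saleProb μ ⁻¹' {saleProb μ t}) = 0 := by
    rw [← Measure.map_apply hm (measurableSet_singleton _), map_saleProb h0,
      Measure.restrict_apply (measurableSet_singleton _)]
    exact measure_mono_null Set.inter_subset_left (by simp)
  have hae : μ.restrict (Set.Ici t) =
      μ.restrict (saleProb μ ⁻¹' Set.Iic (saleProb μ t)) := by
    refine Measure.restrict_congr_set (ae_eq_set.2 ⟨?_, ?_⟩)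
    · have h : Set.Ici t ⊆ saleProb μ ⁻¹' Set.Iic (saleProb μ t) :=
        fun z hz => saleProb_antitone hz
      rw [Set.sdiff_eq_empty.2 h, measure_empty]
    · refine measure_mono_null (fun z hz => ?_) hlevel
      exact le_antisymm hz.1 (saleProb_antitone (not_le.1 hz.2).le)
  rw [hae, ← setLIntegral_map measurableSet_Iic hf hm, map_saleProb h0,
    Measure.restrict_restrict measurableSet_Iic]
  rcases (saleProb_le_one (μ := μ) t).lt_or_eq with h | h
  · have h2 : Set.Iic (saleProb μ t) ∩ Set.Ioo 0 1 = Set.Ioc 0 (saleProb μ t) := by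
      ext y; simp only [Set.mem_inter_iff, Set.mem_Iic, Set.mem_Ioo, Set.mem_Ioc]
      constructor
      · rintro ⟨a, b, _⟩; exact ⟨b, a⟩
      · rintro ⟨a, b⟩; exact ⟨b, a, b.trans_lt h⟩
    rw [h2]
    exact setLIntegral_congr Ioo_ae_eq_Ioc.symm
  · have h2 : Set.Iic (saleProb μ t) ∩ Set.Ioo 0 1 = Set.Ioo 0 (saleProb μ t) := by
      rw [h]; exact Set.inter_eq_right.2 fun y hy => hy.2.le
    rw [h2]

end SaleProb

/-! ### The ironed revenue curve as a concave function. -/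

/-- An atomless value distribution on `[0, ∞)` for which the revenue of a posted price tends to `0`
as the price tends to infinity. -/
class ValueDistribution (μ : Measure ℝ) : Prop extends IsProbabilityMeasure μ,
    NullSingletonClass μ where
  nonneg : μ (Set.Iio 0) = 0
  tail : Tendsto (fun p : ℝ => p * saleProb μ p) atTop (𝓝 0)

/-- The line `a + b q` lies above the revenue curve. -/
def IsRevenueMajorant (μ : Measure ℝ) (a b : ℝ) : Prop :=
  ∀ p, 0 ≤ p → p * saleProb μ p ≤ a + b * saleProb μ p

/-- The right derivative of the ironed revenue curve. -/
noncomputable def ironedMarginal (μ : Measure ℝ) (x : ℝ) : ℝ :=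
  derivWithin (ironedRevenue μ) (Set.Ioi x) x

theorem measurable_ironedMarginal {μ : Measure ℝ} : Measurable (ironedMarginal μ) :=
  measurable_derivWithin_Ioi (ironedRevenue μ)

section IronedRevenue

variable {μ : Measure ℝ} [ValueDistribution μ]

theorem saleProb_eq_one_of_nonpos {p : ℝ} (hp : p ≤ 0) : saleProb μ p = 1 :=
  saleProb_of_nonpos ValueDistribution.nonneg hp

theorem saleProb_mem_Icc (p : ℝ) : saleProb μ p ∈ Set.Icc (0 : ℝ) 1 :=
  ⟨saleProb_nonneg p, saleProb_le_one p⟩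

/-- The tail condition makes the revenue curve approach the origin as the price tends to infinity.
-/
theorem IsRevenueMajorant.intercept_nonneg {a b : ℝ} (h : IsRevenueMajorant μ a b) : 0 ≤ a := by
  have h2 : Tendsto (fun p : ℝ => a + b * saleProb μ p) atTop (𝓝 (a + b * 0)) :=
    tendsto_const_nhds.add (tendsto_saleProb_atTop.const_mul b)
  have := le_of_tendsto_of_tendsto (ValueDistribution.tail (μ := μ)) h2
    ((eventually_ge_atTop 0).mono h)
  simpa using this

theorem IsRevenueMajorant.nonneg {a b : ℝ} (h : IsRevenueMajorant μ a b) {x : ℝ}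
    (hx : x ∈ Set.Icc (0 : ℝ) 1) : 0 ≤ a + b * x := by
  have ha := h.intercept_nonneg
  have hab := h 0 le_rfl
  rw [saleProb_eq_one_of_nonpos le_rfl] at hab
  nlinarith [hx.1, hx.2, mul_nonneg ha (sub_nonneg.2 hx.2)]

/-- Beyond a price `P` the revenue is below `ε`; up to `P` it is at most `P` times the sale
probability. Letting `ε` tend to `0` gives `R̄(0) = 0`. -/
theorem exists_isRevenueMajorant {ε : ℝ} (hε : 0 < ε) :
    ∃ b, 0 ≤ b ∧ IsRevenueMajorant μ ε b := by
  obtain ⟨P, hP⟩ := eventually_atTop.1 ((ValueDistribution.tail (μ := μ)).eventually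
    (gt_mem_nhds hε))
  refine ⟨max P 0, le_max_right _ _, fun p _ => ?_⟩
  have hq := saleProb_nonneg (μ := μ) p
  rcases le_total P p with h | h
  · have := hP p h
    have h2 : 0 ≤ max P 0 * saleProb μ p := mul_nonneg (le_max_right _ _) hq
    linarith
  · have : p * saleProb μ p ≤ max P 0 * saleProb μ p :=
      mul_le_mul_of_nonneg_right (h.trans (le_max_left _ _)) hq
    linarith

theorem ironedRevenue_le {a b : ℝ} (h : IsRevenueMajorant μ a b) {x : ℝ}
    (hx : x ∈ Set.Icc (0 : ℝ) 1) : ironedRevenue μ x ≤ a + b * x := by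
  refine csInf_le ⟨0, ?_⟩ ⟨a, b, h, rfl⟩
  rintro y ⟨a, b, h', rfl⟩
  exact IsRevenueMajorant.nonneg h' hx

theorem le_ironedRevenue {x y : ℝ} (h : ∀ a b, IsRevenueMajorant μ a b → y ≤ a + b * x) :
    y ≤ ironedRevenue μ x := by
  obtain ⟨b, -, hb⟩ := exists_isRevenueMajorant (μ := μ) one_pos
  refine le_csInf ⟨_, 1, b, hb, rfl⟩ ?_
  rintro y ⟨a, b, h', rfl⟩
  exact h a b h'

theorem exists_majorant_lt {x y : ℝ} (h : ironedRevenue μ x < y) :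
    ∃ a b, IsRevenueMajorant μ a b ∧ a + b * x < y := by
  by_contra! hc
  exact absurd (le_ironedRevenue hc) (not_le.2 h)

theorem ironedRevenue_nonneg {x : ℝ} (hx : x ∈ Set.Icc (0 : ℝ) 1) : 0 ≤ ironedRevenue μ x :=
  le_ironedRevenue fun _ _ h => h.nonneg hx

theorem price_mul_saleProb_le {p : ℝ} (hp : 0 ≤ p) :
    p * saleProb μ p ≤ ironedRevenue μ (saleProb μ p) :=
  le_ironedRevenue fun _ _ h => h p hp

theorem ironedRevenue_zero : ironedRevenue μ 0 = 0 := by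
  refine le_antisymm (le_of_forall_gt_imp_ge_of_dense fun ε hε => ?_)
    (ironedRevenue_nonneg (by simp))
  obtain ⟨b, -, hb⟩ := exists_isRevenueMajorant (μ := μ) hε
  simpa using ironedRevenue_le hb (x := 0) (by simp)

theorem concaveOn_ironedRevenue : ConcaveOn ℝ (Set.Icc 0 1) (ironedRevenue μ) := by
  refine ⟨convex_Icc 0 1, fun x hx y hy s t hs ht hst => le_ironedRevenue fun a b h => ?_⟩
  have h1 := mul_le_mul_of_nonneg_left (ironedRevenue_le h hx) hs
  have h2 := mul_le_mul_of_nonneg_left (ironedRevenue_le h hy) ht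
  simp only [smul_eq_mul]
  calc _ ≤ s * (a + b * x) + t * (a + b * y) := add_le_add h1 h2
    _ = (s + t) * a + b * (s * x + t * y) := by ring
    _ = _ := by rw [hst, one_mul]

/-- Upper semicontinuity holds because the curve is an infimum of lines. Lower semicontinuity comes
from concavity in the interior, from nonnegativity and `R̄(0) = 0` at `0`, and from the chord
through the origin at `1`. -/
theorem continuousOn_ironedRevenue : ContinuousOn (ironedRevenue μ) (Set.Icc 0 1) := by
  intro x hx
  refine tendsto_order.2 ⟨fun y hy => ?_, fun y hy => ?_⟩
  · rcases hx.1.eq_or_lt with rfl | hx0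
    · rw [ironedRevenue_zero] at hy
      filter_upwards [self_mem_nhdsWithin] with z hz using hy.trans_le (ironedRevenue_nonneg hz)
    rcases hx.2.eq_or_lt with rfl | hx1
    · have hl : ∀ z ∈ Set.Icc (0 : ℝ) 1, z * ironedRevenue μ 1 ≤ ironedRevenue μ z := by
        intro z hz
        have := concaveOn_ironedRevenue (μ := μ).2 (x := 1) (y := 0) (by simp) (by simp) hz.1
          (sub_nonneg.2 hz.2) (by ring)
        simpa [ironedRevenue_zero] using this
      have ht : Tendsto (fun z => z * ironedRevenue μ 1) (𝓝[Set.Icc (0 : ℝ) 1] 1)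
          (𝓝 (1 * ironedRevenue μ 1)) :=
        ((continuous_id.mul continuous_const).tendsto 1).mono_left nhdsWithin_le_nhds
      rw [one_mul] at ht
      filter_upwards [self_mem_nhdsWithin, ht.eventually (lt_mem_nhds hy)] with z hz hz2
        using hz2.trans_le (hl z hz)
    · have hc : ContinuousOn (ironedRevenue μ) (Set.Ioo 0 1) :=
        (concaveOn_ironedRevenue.subset Set.Ioo_subset_Icc_self (convex_Ioo 0 1)).continuousOn
          isOpen_Ioo
      exact (((hc.continuousAt (Ioo_mem_nhds hx0 hx1)).tendsto).eventually
        (lt_mem_nhds hy)).filter_mono nhdsWithin_le_nhds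
  · obtain ⟨a, b, hab, hlt⟩ := exists_majorant_lt hy
    have ht : Tendsto (fun z => a + b * z) (𝓝[Set.Icc (0 : ℝ) 1] x) (𝓝 (a + b * x)) :=
      ((continuous_const.add (continuous_const.mul continuous_id)).tendsto x).mono_left
        nhdsWithin_le_nhds
    filter_upwards [self_mem_nhdsWithin, ht.eventually (gt_mem_nhds hlt)] with z hz hz2
      using (ironedRevenue_le hab hz).trans_lt hz2

theorem continuous_ironedRevenue_saleProb :
    Continuous fun p => ironedRevenue μ (saleProb μ p) :=
  continuousOn_ironedRevenue.comp_continuous continuous_saleProb saleProb_mem_Icc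

theorem hasDerivWithinAt_ironedRevenue {x : ℝ} (hx : x ∈ Set.Ioo (0 : ℝ) 1) :
    HasDerivWithinAt (ironedRevenue μ) (ironedMarginal μ x) (Set.Ioi x) x := by
  have h := (concaveOn_ironedRevenue (μ := μ)).neg.hasDerivWithinAt_rightDeriv_of_mem_interior
    (x := x) (by rwa [interior_Icc])
  have h' := h.neg
  rw [neg_neg] at h'
  exact h'.differentiableWithinAt.hasDerivWithinAt

theorem antitoneOn_ironedMarginal : AntitoneOn (ironedMarginal μ) (Set.Ioo 0 1) := by
  have h := (concaveOn_ironedRevenue (μ := μ)).neg.monotoneOn_rightDeriv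
  rw [interior_Icc] at h
  intro x hx y hy hxy
  have := h hx hy hxy
  simp only [derivWithin.neg] at this
  exact neg_le_neg_iff.1 this

theorem slope_le_ironedMarginal {x y : ℝ} (hx : x ∈ Set.Ioo (0 : ℝ) 1) (hy : y ≤ 1)
    (hxy : x < y) : (ironedRevenue μ y - ironedRevenue μ x) / (y - x) ≤ ironedMarginal μ x := by
  rw [← slope_def_field]
  exact concaveOn_ironedRevenue.slope_le_rightDeriv ⟨hx.1.le, hx.2.le⟩
    ⟨hx.1.le.trans hxy.le, hy⟩ hxy (hasDerivWithinAt_ironedRevenue hx).differentiableWithinAt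

theorem ironedMarginal_le_slope {x y : ℝ} (hx : x ∈ Set.Ioo (0 : ℝ) 1) (hy : 0 ≤ y)
    (hyx : y < x) : ironedMarginal μ x ≤ (ironedRevenue μ x - ironedRevenue μ y) / (x - y) := by
  have hd := (hasDerivWithinAt_ironedRevenue (μ := μ) hx)
  rw [hasDerivWithinAt_iff_tendsto_slope' (by simp)] at hd
  refine le_of_tendsto hd ?_
  filter_upwards [Ioo_mem_nhdsGT hx.2] with z hz
  rw [slope_def_field]
  exact concaveOn_ironedRevenue.slope_anti_adjacent ⟨hy, hyx.le.trans hx.2.le⟩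
    ⟨hx.1.le.trans hz.1.le, hz.2.le⟩ hyx hz.1

/-- The ironed revenue curve is the integral of its right derivative, wherever the latter is
nonnegative. -/
theorem lintegral_ironedMarginal {s : ℝ} (hs : s ∈ Set.Icc (0 : ℝ) 1)
    (h : ∀ x ∈ Set.Ioo 0 s, 0 ≤ ironedMarginal μ x) :
    ∫⁻ x in Set.Ioo 0 s, ENNReal.ofReal (ironedMarginal μ x) =
      ENNReal.ofReal (ironedRevenue μ s) := by
  have hc : ContinuousOn (ironedRevenue μ) (Set.Icc 0 s) :=
    continuousOn_ironedRevenue.mono (Set.Icc_subset_Icc_right hs.2)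
  have hd : ∀ x ∈ Set.Ioo 0 s,
      HasDerivWithinAt (ironedRevenue μ) (ironedMarginal μ x) (Set.Ioi x) x :=
    fun x hx => hasDerivWithinAt_ironedRevenue ⟨hx.1, hx.2.trans_le hs.2⟩
  have hi := intervalIntegral.integrableOn_deriv_right_of_nonneg hc hd h
  have hint := intervalIntegral.integral_eq_sub_of_hasDeriv_right_of_le_real hs.1 hc hd
    ((integrableOn_Icc_iff_integrableOn_Ioc (by simp)).2 hi)
  rw [ironedRevenue_zero, sub_zero, intervalIntegral.integral_of_le hs.1,
    setIntegral_congr_set Ioo_ae_eq_Ioc.symm] at hint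
  rw [← hint, ofReal_integral_eq_lintegral_ofReal (hi.mono_set Set.Ioo_subset_Ioc_self)]
  exact (ae_restrict_iff' measurableSet_Ioo).2 (Eventually.of_forall h)

/-- A maximizer of the concave curve separates nonnegative slopes from nonpositive ones, which
reduces integrals of the positive part to the interval below `c`. -/
theorem exists_ironedRevenue_argmax : ∃ c ∈ Set.Icc (0 : ℝ) 1,
    (∀ x ∈ Set.Icc (0 : ℝ) 1, ironedRevenue μ x ≤ ironedRevenue μ c) ∧
    (∀ x ∈ Set.Ioo 0 c, 0 ≤ ironedMarginal μ x) ∧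
    ∀ x ∈ Set.Ioo c 1, ironedMarginal μ x ≤ 0 := by
  obtain ⟨c, hc, hmax⟩ := isCompact_Icc.exists_isMaxOn (Set.nonempty_Icc.2 zero_le_one)
    (continuousOn_ironedRevenue (μ := μ))
  refine ⟨c, hc, hmax, fun x hx => ?_, fun x hx => ?_⟩
  · have hx' : x ∈ Set.Ioo (0 : ℝ) 1 := ⟨hx.1, hx.2.trans_le hc.2⟩
    refine le_trans (div_nonneg (sub_nonneg.2 ?_) (sub_nonneg.2 hx.2.le))
      (slope_le_ironedMarginal hx' hc.2 hx.2)
    exact hmax (Set.Ioo_subset_Icc_self hx')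
  · have hx' : x ∈ Set.Ioo (0 : ℝ) 1 := ⟨hc.1.trans_lt hx.1, hx.2⟩
    refine (ironedMarginal_le_slope hx' hc.1 hx.1).trans
      (div_nonpos_of_nonpos_of_nonneg (sub_nonpos.2 ?_) (sub_nonneg.2 hx.1.le))
    exact hmax (Set.Ioo_subset_Icc_self hx')

theorem ironedRevenue_le_lintegral {s : ℝ} (hs : s ∈ Set.Icc (0 : ℝ) 1) :
    ENNReal.ofReal (ironedRevenue μ s) ≤
      ∫⁻ x in Set.Ioo 0 s, ENNReal.ofReal (ironedMarginal μ x) := by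
  obtain ⟨c, hc, hmax, hpos, -⟩ := exists_ironedRevenue_argmax (μ := μ)
  rcases le_total s c with h | h
  · exact (lintegral_ironedMarginal hs fun x hx => hpos x ⟨hx.1, hx.2.trans_le h⟩).ge
  · calc _ ≤ ENNReal.ofReal (ironedRevenue μ c) := ENNReal.ofReal_le_ofReal (hmax s hs)
      _ = _ := (lintegral_ironedMarginal hc hpos).symm
      _ ≤ _ := lintegral_mono_set (Set.Ioo_subset_Ioo_right h)

theorem lintegral_ironedMarginal_lt_top :
    ∫⁻ x in Set.Ioo 0 1, ENNReal.ofReal (ironedMarginal μ x) < ⊤ := by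
  obtain ⟨c, hc, hmax, hpos, hneg⟩ := exists_ironedRevenue_argmax (μ := μ)
  have hsub : Set.Ioo (0 : ℝ) 1 ⊆ Set.Ioo 0 c ∪ ({c} ∪ Set.Ioo c 1) := by
    intro x hx
    rcases lt_trichotomy x c with h | h | h
    · exact Or.inl ⟨hx.1, h⟩
    · exact Or.inr (Or.inl h)
    · exact Or.inr (Or.inr ⟨h, hx.2⟩)
  have h1 : ∫⁻ x in {c}, ENNReal.ofReal (ironedMarginal μ x) = 0 :=
    setLIntegral_measure_zero _ _ (by simp)
  have h2 : ∫⁻ x in Set.Ioo c 1, ENNReal.ofReal (ironedMarginal μ x) = 0 := by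
    rw [setLIntegral_congr_fun measurableSet_Ioo
      (fun x hx => ENNReal.ofReal_of_nonpos (hneg x hx))]
    simp
  calc _ ≤ ∫⁻ x in Set.Ioo 0 c ∪ ({c} ∪ Set.Ioo c 1), ENNReal.ofReal (ironedMarginal μ x) :=
        lintegral_mono_set hsub
    _ ≤ (∫⁻ x in Set.Ioo 0 c, ENNReal.ofReal (ironedMarginal μ x)) + (0 + 0) := by
        refine (lintegral_union_le _ _ _).trans (add_le_add le_rfl ?_)
        refine (lintegral_union_le _ _ _).trans (add_le_add h1.le h2.le)
    _ < ⊤ := by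
        rw [lintegral_ironedMarginal hc hpos]
        simp

end IronedRevenue

/-! ### Ironed virtual values and the revenue of posted prices. -/

section VirtualValue

variable {μ : Measure ℝ} [ValueDistribution μ]

/-- If the revenue curve stays below both `R̄(u)` and `R̄(w)` between `u` and `w`, the ironed
revenue curve is affine there. -/
theorem ironedMarginal_eq_of_forall_le {u w : ℝ} (hu : 0 ≤ u) (huw : u < w) (hw : w ≤ 1)
    (hlu : ∀ p, 0 ≤ p → saleProb μ p ∈ Set.Ioo u w → p * saleProb μ p ≤ ironedRevenue μ u)
    (hlw : ∀ p, 0 ≤ p → saleProb μ p ∈ Set.Ioo u w → p * saleProb μ p ≤ ironedRevenue μ w) :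
    ∀ x ∈ Set.Ico u w,
      ironedMarginal μ x = (ironedRevenue μ w - ironedRevenue μ u) / (w - u) := by
  intro x hx
  set R := ironedRevenue μ with hR
  set m := (R w - R u) / (w - u) with hm
  have hwu : 0 < w - u := sub_pos.2 huw
  have hmw : m * (w - u) = R w - R u := div_mul_cancel₀ _ hwu.ne'
  have hconc : ConcaveOn ℝ (Set.Icc 0 1) R := concaveOn_ironedRevenue
  have hu' : u ∈ Set.Icc (0 : ℝ) 1 := ⟨hu, huw.le.trans hw⟩
  have hw' : w ∈ Set.Icc (0 : ℝ) 1 := ⟨hu.trans huw.le, hw⟩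
  -- The chord of `R̄` over `[u, w]` dominates the revenue curve: outside by concavity of `R̄`,
  -- inside because the chord stays above the smaller of its two end values.
  have hmaj : IsRevenueMajorant μ (R u - m * u) m := by
    intro p hp
    have hpR : p * saleProb μ p ≤ R (saleProb μ p) := price_mul_saleProb_le hp
    have hq := saleProb_mem_Icc (μ := μ) p
    rcases lt_trichotomy (saleProb μ p) u with h | h | h
    · have h1 := hconc.slope_anti_adjacent hq hw' h huw
      rw [← hm, le_div_iff₀ (sub_pos.2 h)] at h1
      linarith
    · rw [h] at hpR ⊢; linarith
    rcases lt_trichotomy (saleProb μ p) w with h' | h' | h'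
    · have h1 := hlu p hp ⟨h, h'⟩
      have h2 := hlw p hp ⟨h, h'⟩
      rcases le_total 0 m with h0 | h0
      · nlinarith [mul_nonneg h0 (sub_pos.2 h).le]
      · nlinarith [mul_nonneg (neg_nonneg.2 h0) (sub_pos.2 h').le]
    · rw [h'] at hpR ⊢; linarith
    · have h1 := hconc.slope_anti_adjacent hu' hq huw h'
      rw [← hm, div_le_iff₀ (sub_pos.2 h')] at h1
      linarith
  have haff : ∀ y ∈ Set.Ico u w, R y = R u - m * u + m * y := by
    intro y hy
    refine le_antisymm (ironedRevenue_le hmaj ⟨hu.trans hy.1, hy.2.le.trans hw⟩) ?_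
    have h1 := hconc.2 hu' hw'
      (div_nonneg (sub_nonneg.2 hy.2.le) hwu.le) (div_nonneg (sub_nonneg.2 hy.1) hwu.le)
      (by rw [← add_div, div_eq_one_iff_eq hwu.ne']; ring)
    simp only [smul_eq_mul] at h1
    have h2 : (w - y) / (w - u) * u + (y - u) / (w - u) * w = y := by
      field_simp; ring
    have h3 : (w - y) / (w - u) * R u + (y - u) / (w - u) * R w = R u - m * u + m * y := by
      rw [hm]; field_simp; ring
    rwa [h2, h3] at h1
  -- Only points to the right of `x` matter, so `x = u` is allowed and `x = w` is not.
  have hev : R =ᶠ[𝓝[>] x] fun y => R u - m * u + m * y := by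
    filter_upwards [Ioo_mem_nhdsGT hx.2] with y hy using haff y ⟨hx.1.trans hy.1.le, hy.2⟩
  rw [ironedMarginal, ← hR, hev.derivWithin_eq (haff x hx)]
  have hd : HasDerivAt (fun y => R u - m * u + m * y) m x := by
    simpa using ((hasDerivAt_id x).const_mul m).const_add (R u - m * u)
  exact hd.hasDerivWithinAt.derivWithin (uniqueDiffWithinAt_Ioi x)

theorem ironedVirtualValue_of_lt {μ : Measure ℝ} {v : ℝ} (h : saleProb μ v < 1) :
    ironedVirtualValue μ v = (ironedMarginal μ (saleProb μ v) : EReal) := if_pos h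

theorem ironedVirtualValue_eq_bot_iff {v : ℝ} :
    ironedVirtualValue μ v = ⊥ ↔ saleProb μ v = 1 := by
  constructor
  · intro h
    by_contra hne
    rw [ironedVirtualValue_of_lt (lt_of_le_of_ne (saleProb_le_one v) hne)] at h
    exact EReal.coe_ne_bot _ h
  · intro h
    exact if_neg h.not_lt

theorem ironedVirtualValue_ne_top {μ : Measure ℝ} {v : ℝ} : ironedVirtualValue μ v ≠ ⊤ := by
  unfold ironedVirtualValue
  split_ifs <;> simp

theorem ironedVirtualValue_congr {μ : Measure ℝ} {v w : ℝ} (h : saleProb μ v = saleProb μ w) :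
    ironedVirtualValue μ v = ironedVirtualValue μ w := by
  unfold ironedVirtualValue
  rw [h]

/-- If some price is never accepted, the ironed revenue curve has a right derivative at `0`. -/
theorem differentiableWithinAt_ironedRevenue_zero {z : ℝ} (hz : saleProb μ z = 0) :
    DifferentiableWithinAt ℝ (ironedRevenue μ) (Set.Ioi 0) 0 := by
  have hmaj : IsRevenueMajorant μ 0 z := by
    intro p _
    rcases le_total p z with h | h
    · simpa using mul_le_mul_of_nonneg_right h (saleProb_nonneg p)
    · have : saleProb μ p = 0 :=
        le_antisymm (hz ▸ saleProb_antitone h) (saleProb_nonneg p)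
      simp [this]
  -- Truncation at `1` makes the quotient antitone on the whole half-line.
  set f : ℝ → ℝ := fun x => ironedRevenue μ (min x 1) / min x 1 with hf
  have hanti : AntitoneOn f (Set.Ioi 0) := by
    intro x hx y hy hxy
    have hx' : 0 < min x 1 := lt_min hx one_pos
    rcases (min_le_min_right 1 hxy).eq_or_lt with h | h
    · simp only [hf, h, le_refl]
    · have h1 := (concaveOn_ironedRevenue (μ := μ)).slope_anti_adjacent (x := 0) (by simp)
        ⟨hx'.le.trans h.le, min_le_right y 1⟩ hx' h
      rw [ironedRevenue_zero, sub_zero, sub_zero, div_le_iff₀ (sub_pos.2 h)] at h1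
      simp only [hf]
      rw [div_le_iff₀ (hx'.trans h)]
      have h2 : ironedRevenue μ (min x 1) / min x 1 * min x 1 = ironedRevenue μ (min x 1) :=
        div_mul_cancel₀ _ hx'.ne'
      linarith
  have hbdd : BddAbove (f '' Set.Ioi 0) := by
    refine ⟨z, ?_⟩
    rintro _ ⟨x, hx, rfl⟩
    have hx' : 0 < min x 1 := lt_min hx one_pos
    simp only [hf]
    rw [div_le_iff₀ hx']
    simpa using ironedRevenue_le hmaj (x := min x 1) ⟨hx'.le, min_le_right _ _⟩
  have ht := hanti.tendsto_nhdsGT hbdd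
  refine HasDerivWithinAt.differentiableWithinAt (f' := sSup (f '' Set.Ioi 0)) ?_
  rw [hasDerivWithinAt_iff_tendsto_slope' (by simp)]
  refine ht.congr' ?_
  filter_upwards [Ioo_mem_nhdsGT (zero_lt_one (α := ℝ))] with x hx
  rw [slope_def_field, ironedRevenue_zero, sub_zero, sub_zero]
  simp only [hf, min_eq_left hx.2.le]

theorem monotone_ironedVirtualValue : Monotone (ironedVirtualValue μ) := by
  intro z z' hzz
  have hq := saleProb_antitone (μ := μ) hzz
  rcases (saleProb_le_one (μ := μ) z).eq_or_lt with h1 | h1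
  · rw [ironedVirtualValue_eq_bot_iff.2 h1]; exact bot_le
  rw [ironedVirtualValue_of_lt h1, ironedVirtualValue_of_lt (hq.trans_lt h1),
    EReal.coe_le_coe_iff]
  rcases hq.eq_or_lt with h | h
  · rw [h]
  rcases (saleProb_nonneg (μ := μ) z').eq_or_lt with h0 | h0
  · have hz : saleProb μ z ∈ Set.Ioo (0 : ℝ) 1 := ⟨h0.trans_lt h, h1⟩
    rw [← h0]
    refine (ironedMarginal_le_slope hz le_rfl hz.1).trans ?_
    rw [← slope_def_field]
    exact concaveOn_ironedRevenue.slope_le_rightDeriv (by simp) (Set.Ioo_subset_Icc_self hz)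
      hz.1 (differentiableWithinAt_ironedRevenue_zero h0.symm)
  · exact antitoneOn_ironedMarginal ⟨h0, h.trans h1⟩ ⟨h0.trans h, h1⟩ h.le

theorem measurable_ironedVirtualValue : Measurable (ironedVirtualValue μ) :=
  monotone_ironedVirtualValue.measurable

theorem pos_of_ironedVirtualValue_ne_bot {v : ℝ} (h : ironedVirtualValue μ v ≠ ⊥) : 0 < v := by
  by_contra! hv
  exact h (ironedVirtualValue_eq_bot_iff.2 (saleProb_eq_one_of_nonpos hv))

theorem lintegral_ironedVirtualValue (t : ℝ) :
    ∫⁻ v in Set.Ici t, (ironedVirtualValue μ v).toENNReal ∂μ =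
      ∫⁻ x in Set.Ioo 0 (saleProb μ t), ENNReal.ofReal (ironedMarginal μ x) := by
  -- The cutoff reflects the value `⊥` at sale probability `1`.
  set f : ℝ → ENNReal := fun x => if x < 1 then ENNReal.ofReal (ironedMarginal μ x) else 0 with hf
  have hfm : Measurable f := Measurable.ite measurableSet_Iio
    measurable_ironedMarginal.ennreal_ofReal measurable_const
  have h1 : ∀ v, (ironedVirtualValue μ v).toENNReal = f (saleProb μ v) := by
    intro v
    rcases (saleProb_le_one (μ := μ) v).eq_or_lt with h | h
    · rw [ironedVirtualValue_eq_bot_iff.2 h, h]; simp [hf]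
    · rw [ironedVirtualValue_of_lt h]; simp [hf, h]
  simp_rw [h1]
  rw [setLIntegral_comp_saleProb ValueDistribution.nonneg hfm]
  refine setLIntegral_congr_fun measurableSet_Ioo fun x hx => ?_
  simp [hf, hx.2.trans_le (saleProb_le_one t)]

/-- The revenue of a posted price is at most the expected positive part of the ironed virtual
value above that price. -/
theorem price_mul_measure_le {t : ℝ} (ht : 0 ≤ t) :
    ENNReal.ofReal t * μ (Set.Ici t) ≤
      ∫⁻ v in Set.Ici t, (ironedVirtualValue μ v).toENNReal ∂μ := by
  rw [lintegral_ironedVirtualValue, ← ofReal_saleProb, ← ENNReal.ofReal_mul ht]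
  exact (ENNReal.ofReal_le_ofReal (price_mul_saleProb_le ht)).trans
    (ironedRevenue_le_lintegral (saleProb_mem_Icc t))

theorem lintegral_ironedVirtualValue_lt_top :
    ∫⁻ v, (ironedVirtualValue μ v).toENNReal ∂μ < ⊤ := by
  have h : ∀ᵐ v ∂μ, v ∈ Set.Ici (0 : ℝ) := by
    rw [ae_iff]
    convert ValueDistribution.nonneg (μ := μ) using 2
    ext v; simp
  have h2 := lintegral_ironedVirtualValue (μ := μ) 0
  rw [Measure.restrict_eq_self_of_ae_mem h, saleProb_eq_one_of_nonpos le_rfl] at h2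
  rw [h2]
  exact lintegral_ironedMarginal_lt_top

/-- The ironed revenue curve and the revenue curve agree at the lower end of a set of values that
is determined by the ironed virtual value. -/
theorem ironedRevenue_saleProb_sInf_le {W : Set ℝ} (hne : W.Nonempty)
    (hup : ∀ z ∈ W, ∀ z', z ≤ z' → z' ∈ W)
    (hcongr : ∀ z ∈ W, ∀ z', ironedVirtualValue μ z' = ironedVirtualValue μ z → z' ∈ W)
    (hbot : ∀ z ∈ W, ironedVirtualValue μ z ≠ ⊥) :
    ironedRevenue μ (saleProb μ (sInf W)) ≤ sInf W * saleProb μ (sInf W) := by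
  set t := sInf W with ht
  have hbdd : BddBelow W := ⟨0, fun z hz => (pos_of_ironedVirtualValue_ne_bot (hbot z hz)).le⟩
  have hgt : ∀ z, t < z → z ∈ W := by
    intro z hz
    obtain ⟨y, hy, hyz⟩ := exists_lt_of_csInf_lt hne hz
    exact hup y hy z hyz.le
  have htl : ∀ z ∈ W, t ≤ z := fun z hz => csInf_le hbdd hz
  have ht0 : 0 ≤ t := le_csInf hne fun z hz => (pos_of_ironedVirtualValue_ne_bot (hbot z hz)).le
  have hlt1 : ∀ z ∈ W, saleProb μ z < 1 := fun z hz =>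
    lt_of_le_of_ne (saleProb_le_one z) fun h => hbot z hz (ironedVirtualValue_eq_bot_iff.2 h)
  have hs0 := saleProb_nonneg (μ := μ) t
  by_contra! hlt
  -- If the envelope were strictly above the curve at `t`, it would be affine nearby and the virtual
  -- value constant around `t`. When `t ∈ W`, this puts some `y < t` into `W`; when `t ∉ W`, it puts
  -- `t` itself into `W`.
  by_cases htW : t ∈ W
  · have hs1 := hlt1 t htW
    have hcq : Tendsto (fun z => t * saleProb μ z) (𝓝 t) (𝓝 (t * saleProb μ t)) :=
      (continuous_const.mul continuous_saleProb).tendsto t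
    have e1 : ∀ᶠ z in 𝓝 t, t * saleProb μ z < ironedRevenue μ (saleProb μ z) :=
      hcq.eventually_lt (continuous_ironedRevenue_saleProb.tendsto t) hlt
    have e2 : ∀ᶠ z in 𝓝 t, t * saleProb μ z < ironedRevenue μ (saleProb μ t) :=
      hcq.eventually (gt_mem_nhds hlt)
    obtain ⟨z, ⟨hz1, hz2⟩, hzt⟩ := (((e1.and e2).filter_mono nhdsWithin_le_nhds).and
      (self_mem_nhdsWithin (a := t) (s := Set.Iio t))).exists
    have hzt : z < t := hzt
    have hzW : ∀ z < t, z ∉ W := fun z hz h => absurd (htl z h) (not_le.2 hz)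
    have hsz : saleProb μ t < saleProb μ z := by
      refine lt_of_le_of_ne (saleProb_antitone hzt.le) fun h => hzW z hzt ?_
      exact hcongr t htW z (ironedVirtualValue_congr h.symm)
    have hp : ∀ p, saleProb μ p ∈ Set.Ioo (saleProb μ t) (saleProb μ z) →
        p * saleProb μ p ≤ t * saleProb μ z := by
      intro p hp
      have hpt : p < t := by
        by_contra! h
        exact absurd (saleProb_antitone (μ := μ) h) (not_le.2 hp.1)
      exact mul_le_mul hpt.le hp.2.le (saleProb_nonneg p) ht0
    have key := ironedMarginal_eq_of_forall_le hs0 hsz (saleProb_le_one z)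
      (fun p _ h => (hp p h).trans hz2.le) (fun p _ h => (hp p h).trans hz1.le)
    obtain ⟨x, hx1, hx2⟩ := exists_between hsz
    obtain ⟨y, -, hy⟩ := exists_saleProb_eq_of_lt (hs0.trans_lt hx1) hx2
    have hyW : y ∈ W := by
      refine hcongr t htW y ?_
      rw [ironedVirtualValue_of_lt hs1, ironedVirtualValue_of_lt
        (hy ▸ hx2.trans_le (saleProb_le_one z)), hy, key _ ⟨hx1.le, hx2⟩, key _ ⟨le_rfl, hsz⟩]
    have := saleProb_antitone (μ := μ) (htl y hyW)
    rw [hy] at this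
    exact absurd this (not_le.2 hx1)
  · have hqlt : ∀ z, t < z → saleProb μ z < saleProb μ t := by
      intro z hz
      refine lt_of_le_of_ne (saleProb_antitone hz.le) fun h => htW ?_
      exact hcongr z (hgt z hz) t (ironedVirtualValue_congr h.symm)
    -- At sale probability `1` there is no room to the right. Instead, a steep line through `(1, z)`
    -- with `z < R̄(1)` is shown to be a majorant, a contradiction.
    rcases (saleProb_le_one (μ := μ) t).eq_or_lt with hs1 | hs1
    · rw [hs1, mul_one] at hlt
      obtain ⟨z, hz, hzR⟩ := exists_between hlt
      have hz1 := hlt1 z (hgt z hz)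
      obtain ⟨b, hb, hmaj⟩ := exists_isRevenueMajorant (μ := μ) one_pos
      -- `K` is chosen so that the line exceeds `1 + b`, a bound on all revenues, at every price `p
      -- ≥ z`.
      set K := (1 + b) / (1 - saleProb μ z) with hK
      have hd : 0 < 1 - saleProb μ z := sub_pos.2 hz1
      have hKd : K * (1 - saleProb μ z) = 1 + b := div_mul_cancel₀ _ hd.ne'
      have hK0 : 0 ≤ K := by positivity
      have hz0 : 0 ≤ z := ht0.trans hz.le
      have hmaj' : IsRevenueMajorant μ (z + K) (-K) := by
        intro p hp
        have hq0 := saleProb_nonneg (μ := μ) p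
        have hq1 := saleProb_le_one (μ := μ) p
        rcases le_total p z with h | h
        · nlinarith [mul_nonneg hK0 (sub_nonneg.2 hq1), mul_nonneg hp (sub_nonneg.2 hq1)]
        · have h1 := hmaj p hp
          have h2 := mul_le_mul_of_nonneg_left (saleProb_antitone (μ := μ) h) hK0
          nlinarith [mul_nonneg hb (sub_nonneg.2 hq1)]
      have := ironedRevenue_le hmaj' (x := 1) (by simp)
      linarith
    -- The affine interval must extend strictly to the right of the sale probability of `t`, since
    -- virtual values are right derivatives; hence the auxiliary point `w`.
    · have hRc := (continuousOn_ironedRevenue (μ := μ) _ (saleProb_mem_Icc (μ := μ) t)).mono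
        (s := Set.Ioo (saleProb μ t) 1) (fun x hx => ⟨hs0.trans hx.1.le, hx.2.le⟩)
      have hmul : Tendsto (fun x => t * x) (𝓝[Set.Ioo (saleProb μ t) 1] (saleProb μ t))
          (𝓝 (t * saleProb μ t)) :=
        ((continuous_const.mul continuous_id).tendsto _).mono_left nhdsWithin_le_nhds
      have : (𝓝[Set.Ioo (saleProb μ t) 1] (saleProb μ t)).NeBot := by
        rw [nhdsWithin_Ioo_eq_nhdsGT hs1]; infer_instance
      obtain ⟨w, ⟨hw1, hw2⟩, hw⟩ := (((hmul.eventually_lt hRc hlt).and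
        (hmul.eventually (gt_mem_nhds hlt))).and self_mem_nhdsWithin).exists
      have hcz : Tendsto (fun z => z * w) (𝓝 t) (𝓝 (t * w)) :=
        (continuous_id.mul continuous_const).tendsto t
      obtain ⟨z, ⟨hz1, hz2⟩, hzt⟩ := ((((hcz.eventually (gt_mem_nhds hw1)).and
        (hcz.eventually_lt ((continuous_ironedRevenue_saleProb (μ := μ)).tendsto t) hw2)).filter_mono
        nhdsWithin_le_nhds).and (self_mem_nhdsWithin (a := t) (s := Set.Ioi t))).exists
      have hzt : t < z := hzt
      have hp : ∀ p, saleProb μ p ∈ Set.Ioo (saleProb μ z) w → p * saleProb μ p ≤ z * w := by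
        intro p hp
        have hpz : p < z := by
          by_contra! h
          exact absurd (saleProb_antitone (μ := μ) h) (not_le.2 hp.1)
        exact mul_le_mul hpz.le hp.2.le (saleProb_nonneg p) (ht0.trans hzt.le)
      have key := ironedMarginal_eq_of_forall_le (saleProb_nonneg z) ((hqlt z hzt).trans hw.1)
        hw.2.le (fun p _ h => (hp p h).trans hz2.le) (fun p _ h => (hp p h).trans hz1.le)
      refine htW (hcongr z (hgt z hzt) t ?_)
      rw [ironedVirtualValue_of_lt hs1, ironedVirtualValue_of_lt ((hqlt z hzt).trans hs1),
        key _ ⟨(hqlt z hzt).le, hw.1⟩, key _ ⟨le_rfl, (hqlt z hzt).trans hw.1⟩]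

/-- A nonempty upper set that is bounded below is a half-line up to a null set. -/
theorem restrict_eq_restrict_Ici_sInf {W : Set ℝ} (hne : W.Nonempty) (hbdd : BddBelow W)
    (hup : ∀ z ∈ W, ∀ z', z ≤ z' → z' ∈ W) :
    μ.restrict W = μ.restrict (Set.Ici (sInf W)) := by
  refine Measure.restrict_congr_set (ae_eq_set.2 ⟨?_, ?_⟩)
  · have h : W ⊆ Set.Ici (sInf W) := fun z hz => csInf_le hbdd hz
    rw [Set.sdiff_eq_empty.2 h, measure_empty]
  · refine measure_mono_null (fun z hz => ?_) (measure_singleton (sInf W))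
    by_contra hzne
    obtain ⟨y, hy, hyz⟩ := exists_lt_of_csInf_lt hne (lt_of_le_of_ne hz.1 (Ne.symm hzne))
    exact hz.2 (hup y hy z hyz.le)

theorem sInf_mul_measure_le {W : Set ℝ} (hne : W.Nonempty) (hpos : ∀ z ∈ W, 0 ≤ z)
    (hup : ∀ z ∈ W, ∀ z', z ≤ z' → z' ∈ W) :
    ENNReal.ofReal (sInf W) * μ W ≤ ∫⁻ v in W, (ironedVirtualValue μ v).toENNReal ∂μ := by
  have h := restrict_eq_restrict_Ici_sInf (μ := μ) hne ⟨0, hpos⟩ hup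
  rw [h, ← Measure.restrict_apply_univ, h, Measure.restrict_apply_univ]
  exact price_mul_measure_le (le_csInf hne hpos)

/-- The revenue of the price at the lower end of a set of values determined by the ironed virtual
value is the expected ironed virtual value over that set. -/
theorem lintegral_le_sInf_mul_measure {W : Set ℝ} (hne : W.Nonempty)
    (hup : ∀ z ∈ W, ∀ z', z ≤ z' → z' ∈ W)
    (hcongr : ∀ z ∈ W, ∀ z', ironedVirtualValue μ z' = ironedVirtualValue μ z → z' ∈ W)
    (hnonneg : ∀ z ∈ W, 0 ≤ ironedVirtualValue μ z) :
    ∫⁻ v in W, (ironedVirtualValue μ v).toENNReal ∂μ ≤ ENNReal.ofReal (sInf W) * μ W := by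
  have hbot : ∀ z ∈ W, ironedVirtualValue μ z ≠ ⊥ := fun z hz h => by
    simpa [h] using hnonneg z hz
  have hpos : ∀ z ∈ W, 0 ≤ z := fun z hz => (pos_of_ironedVirtualValue_ne_bot (hbot z hz)).le
  have h := restrict_eq_restrict_Ici_sInf (μ := μ) hne ⟨0, hpos⟩ hup
  rw [h, ← Measure.restrict_apply_univ W, h, Measure.restrict_apply_univ,
    lintegral_ironedVirtualValue, lintegral_ironedMarginal (saleProb_mem_Icc _), ← ofReal_saleProb,
    ← ENNReal.ofReal_mul (le_csInf hne hpos)]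
  · exact ENNReal.ofReal_le_ofReal (ironedRevenue_saleProb_sInf_le hne hup hcongr hbot)
  -- Every sale probability below that of `t` is attained at a value above `t`, which lies in `W`.
  · intro x hx
    obtain ⟨z, hz, rfl⟩ := exists_saleProb_eq_of_lt hx.1 hx.2
    obtain ⟨y, hy, hyz⟩ := exists_lt_of_csInf_lt hne hz
    have hzW := hup y hy z hyz.le
    have := hnonneg z hzW
    rw [ironedVirtualValue_of_lt (lt_of_le_of_ne (saleProb_le_one z) fun h =>
      hbot z hzW (ironedVirtualValue_eq_bot_iff.2 h))] at this
    exact_mod_cast this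

end VirtualValue

/-! ### Myerson's mechanism: monotonicity, measurability, expected payments. -/

namespace BSMD

variable {J : Type*}

theorem ironedSurplus_ne_top (I : BSMD J) (v : J → ℝ) (S : Finset J) :
    I.ironedSurplus v S ≠ ⊤ := by
  classical
  unfold ironedSurplus
  induction S using Finset.induction_on with
  | empty => simp
  | insert j S hj ih =>
    rw [Finset.sum_insert hj]
    exact EReal.add_ne_top ironedVirtualValue_ne_top ih

/-- Removing an agent with negative virtual value keeps the set feasible and raises the surplus.
Comparison with `∅` excludes a surplus of `⊥`, for which the increase would not be strict. -/
theorem ironedVirtualValue_nonneg_of_mem [DecidableEq J] (I : BSMD J) {v : J → ℝ} {S : Finset J}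
    (hS : S ∈ I.maximizers v) {j : J} (hj : j ∈ S) :
    0 ≤ ironedVirtualValue (I.dist j) (v j) := by
  have hsum : ironedVirtualValue (I.dist j) (v j) + I.ironedSurplus v (S.erase j) =
      I.ironedSurplus v S :=
    Finset.add_sum_erase S (fun k => ironedVirtualValue (I.dist k) (v k)) hj
  have h0 : 0 ≤ I.ironedSurplus v S := by
    simpa [ironedSurplus] using hS.2 ∅ I.empty_feasible
  have hle := hS.2 (S.erase j) (I.downwardClosed S hS.1 _ (Finset.erase_subset j S))
  have hbot : I.ironedSurplus v (S.erase j) ≠ ⊥ := by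
    intro h
    rw [h, EReal.add_bot] at hsum
    rw [← hsum] at h0
    exact absurd h0 (by simp)
  by_contra! hneg
  have := EReal.add_lt_add_of_lt_of_le hneg (le_refl (I.ironedSurplus v (S.erase j))) hbot
    (I.ironedSurplus_ne_top v _)
  rw [hsum, zero_add] at this
  exact absurd hle (not_le.2 this)

theorem ironedSurplus_update_of_notMem [DecidableEq J] (I : BSMD J) (v : J → ℝ) {j : J} (z : ℝ)
    {S : Finset J} (hj : j ∉ S) :
    I.ironedSurplus (Function.update v j z) S = I.ironedSurplus v S := by
  refine Finset.sum_congr rfl fun k hk => ?_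
  rw [Function.update_of_ne]
  rintro rfl
  exact hj hk

/-- The rule `tie` sees only the collection of maximizers, so winning bids form a union of level
sets of the virtual value however ties are broken. -/
theorem maximizers_update_congr [DecidableEq J] (I : BSMD J) (v : J → ℝ) {j : J} {z z' : ℝ}
    (h : ironedVirtualValue (I.dist j) z = ironedVirtualValue (I.dist j) z') :
    I.maximizers (Function.update v j z) = I.maximizers (Function.update v j z') := by
  have hs : I.ironedSurplus (Function.update v j z) =
      I.ironedSurplus (Function.update v j z') := by
    funext S
    refine Finset.sum_congr rfl fun k _ => ?_
    rcases eq_or_ne k j with rfl | hk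
    · simpa using h
    · simp [Function.update_of_ne hk]
  unfold maximizers
  rw [hs]

theorem myerson_pay_nonneg [DecidableEq J] (I : BSMD J) (tie : Set (Finset J) → Finset J)
    (v : J → ℝ) (j : J) : 0 ≤ (I.myerson tie).pay v j := by
  unfold myerson
  dsimp only
  split_ifs
  · exact Real.sInf_nonneg fun z hz => hz.1
  · exact le_rfl

theorem measurable_ironedSurplus (I : BSMD J) [∀ j, ValueDistribution (I.dist j)] (S : Finset J) :
    Measurable fun v => I.ironedSurplus v S := by
  unfold ironedSurplus
  exact Finset.measurable_sum S fun j _ =>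
    measurable_ironedVirtualValue.comp (measurable_pi_apply j)

variable [Fintype J] {I : BSMD J} {tie : Set (Finset J) → Finset J}

theorem tie_mem_maximizers (htie : ∀ 𝒯 : Set (Finset J), 𝒯.Nonempty → tie 𝒯 ∈ 𝒯) (v : J → ℝ) :
    tie (I.maximizers v) ∈ I.maximizers v :=
  htie _ (I.maximizers_nonempty v)

variable [DecidableEq J]

theorem ironedVirtualValue_nonneg_of_served
    (htie : ∀ 𝒯 : Set (Finset J), 𝒯.Nonempty → tie 𝒯 ∈ 𝒯) {v : J → ℝ} {j : J}
    (hj : j ∈ tie (I.maximizers v)) : 0 ≤ ironedVirtualValue (I.dist j) (v j) :=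
  I.ironedVirtualValue_nonneg_of_mem (tie_mem_maximizers htie v) hj

variable [∀ j, ValueDistribution (I.dist j)]

/-- A served agent is still served if she raises her bid. -/
theorem mem_tie_maximizers_mono (htie : ∀ 𝒯 : Set (Finset J), 𝒯.Nonempty → tie 𝒯 ∈ 𝒯)
    (v : J → ℝ) {j : J} {z z' : ℝ} (hzz : z ≤ z')
    (hj : j ∈ tie (I.maximizers (Function.update v j z))) :
    j ∈ tie (I.maximizers (Function.update v j z')) := by
  -- Equal virtual values give the same maximizers. If the virtual value increases strictly, so does
  -- the surplus of `S`, whereas a set `T` without `j` gains nothing and cannot become optimal.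
  rcases (monotone_ironedVirtualValue (μ := I.dist j) hzz).eq_or_lt with h | h
  · rwa [← I.maximizers_update_congr v h]
  by_contra hj'
  set S := tie (I.maximizers (Function.update v j z))
  set T := tie (I.maximizers (Function.update v j z'))
  have hS : S ∈ I.maximizers (Function.update v j z) := tie_mem_maximizers htie _
  have hT : T ∈ I.maximizers (Function.update v j z') := tie_mem_maximizers htie _
  have hsum : ∀ y, ironedVirtualValue (I.dist j) y + I.ironedSurplus v (S.erase j) =
      I.ironedSurplus (Function.update v j y) S := by
    intro y
    rw [← I.ironedSurplus_update_of_notMem v y (Finset.notMem_erase j S)]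
    have := Finset.add_sum_erase S
      (fun k => ironedVirtualValue (I.dist k) (Function.update v j y k)) hj
    simpa [ironedSurplus] using this
  have hbot : I.ironedSurplus v (S.erase j) ≠ ⊥ := by
    intro hb
    have h0 : 0 ≤ I.ironedSurplus (Function.update v j z) S := by
      simpa [ironedSurplus] using hS.2 ∅ I.empty_feasible
    rw [← hsum, hb, EReal.add_bot] at h0
    exact absurd h0 (by simp)
  have hlt := EReal.add_lt_add_of_lt_of_le h (le_refl (I.ironedSurplus v (S.erase j))) hbot
    (I.ironedSurplus_ne_top v _)
  rw [hsum, hsum] at hlt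
  have h1 := hS.2 T hT.1
  have h2 := hT.2 S hS.1
  rw [I.ironedSurplus_update_of_notMem v _ hj'] at h1 h2
  exact absurd (h2.trans h1) (not_le.2 hlt)

theorem bid_pos_of_served (htie : ∀ 𝒯 : Set (Finset J), 𝒯.Nonempty → tie 𝒯 ∈ 𝒯) {v : J → ℝ}
    {j : J} (hj : j ∈ tie (I.maximizers v)) : 0 < v j := by
  refine pos_of_ironedVirtualValue_ne_bot (μ := I.dist j) fun h => ?_
  have := ironedVirtualValue_nonneg_of_served htie hj
  rw [h] at this
  exact absurd this (by simp)

/-- Bids `z ≤ 0` have virtual value `⊥` and never win, so the constraint `0 ≤ z` is redundant. -/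
theorem myerson_pay_eq (htie : ∀ 𝒯 : Set (Finset J), 𝒯.Nonempty → tie 𝒯 ∈ 𝒯) (v : J → ℝ)
    (j : J) : (I.myerson tie).pay v j = if j ∈ tie (I.maximizers v) then
      sInf {z : ℝ | j ∈ tie (I.maximizers (Function.update v j z))} else 0 := by
  have h : {z : ℝ | 0 ≤ z ∧ j ∈ tie (I.maximizers (Function.update v j z))} =
      {z : ℝ | j ∈ tie (I.maximizers (Function.update v j z))} := by
    ext z
    refine and_iff_right_of_imp fun hz => ?_
    have := bid_pos_of_served htie hz
    rw [Function.update_self] at this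
    exact this.le
  simp only [myerson, h]

theorem measurableSet_served (tie : Set (Finset J) → Finset J) (j : J) :
    MeasurableSet {v : J → ℝ | j ∈ tie (I.maximizers v)} := by
  have hmem : ∀ S, MeasurableSet {v : J → ℝ | S ∈ I.maximizers v} := by
    intro S
    have : {v : J → ℝ | S ∈ I.maximizers v} = {v | S ∈ I.feasible} ∩
        ⋂ T ∈ I.feasible, {v | I.ironedSurplus v T ≤ I.ironedSurplus v S} := by
      ext v; simp [maximizers]
    rw [this]
    exact (MeasurableSet.const _).inter (MeasurableSet.biInter (Set.to_countable _) fun T _ =>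
      measurableSet_le (I.measurable_ironedSurplus T) (I.measurable_ironedSurplus S))
  -- Although `tie` is arbitrary, only finitely many collections of sets can occur as the set of
  -- maximizers.
  have : {v : J → ℝ | j ∈ tie (I.maximizers v)} =
      ⋃ 𝒯 ∈ {𝒯 : Set (Finset J) | j ∈ tie 𝒯}, {v | ∀ S, S ∈ I.maximizers v ↔ S ∈ 𝒯} := by
    ext v
    simp only [Set.mem_ofPred_eq, Set.mem_iUnion, exists_prop]
    constructor
    · exact fun h => ⟨_, h, fun S => Iff.rfl⟩
    · rintro ⟨𝒯, h, h'⟩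
      rwa [Set.ext h']
  rw [this]
  refine MeasurableSet.biUnion (Set.to_countable _) fun 𝒯 _ => ?_
  rw [Set.ofPred_forall]
  refine MeasurableSet.iInter fun S => ?_
  by_cases hS : S ∈ 𝒯
  · simpa [hS] using hmem S
  · simp only [hS, iff_false]
    exact (hmem S).compl

theorem measurable_myerson_pay (htie : ∀ 𝒯 : Set (Finset J), 𝒯.Nonempty → tie 𝒯 ∈ 𝒯) (j : J) :
    Measurable fun v => (I.myerson tie).pay v j := by
  refine measurable_of_Iio fun c => ?_
  rcases le_or_gt c 0 with hc | hc
  · convert MeasurableSet.empty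
    ext v
    simpa using hc.trans (I.myerson_pay_nonneg tie v j)
  -- By monotonicity in the bid, a threshold below `c` is witnessed by a rational winning bid below
  -- `c`.
  have : (fun v => (I.myerson tie).pay v j) ⁻¹' Set.Iio c =
      {v | j ∈ tie (I.maximizers v)}ᶜ ∪ ⋃ r ∈ {r : ℚ | (r : ℝ) < c},
        {v | j ∈ tie (I.maximizers (Function.update v j (r : ℝ)))} := by
    ext v
    simp only [Set.mem_preimage, Set.mem_Iio, Set.mem_union, Set.mem_compl_iff, Set.mem_ofPred_eq,
      Set.mem_iUnion, exists_prop]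
    rw [myerson_pay_eq htie]
    by_cases hj : j ∈ tie (I.maximizers v)
    · simp only [hj, if_true, not_true_eq_false, false_or]
      have hne : {z : ℝ | j ∈ tie (I.maximizers (Function.update v j z))}.Nonempty :=
        ⟨v j, by simpa using hj⟩
      have hbdd : BddBelow {z : ℝ | j ∈ tie (I.maximizers (Function.update v j z))} := by
        refine ⟨0, fun z hz => ?_⟩
        have := bid_pos_of_served htie hz
        rw [Function.update_self] at this
        exact this.le
      rw [csInf_lt_iff hbdd hne]
      constructor
      · rintro ⟨z, hz, hzc⟩
        obtain ⟨r, hr, hrc⟩ := exists_rat_btwn hzc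
        exact ⟨r, hrc, mem_tie_maximizers_mono htie v hr.le hz⟩
      · rintro ⟨r, hrc, hr⟩
        exact ⟨r, hr, hrc⟩
    · simp [hj, hc]
  rw [this]
  exact (measurableSet_served tie j).compl.union (MeasurableSet.biUnion (Set.to_countable _)
    fun r _ => measurable_update_left (measurableSet_served tie j))

/-- The expected payment of an agent in Myerson's mechanism is her expected contribution to the
ironed virtual surplus. -/
theorem lintegral_myerson_pay (htie : ∀ 𝒯 : Set (Finset J), 𝒯.Nonempty → tie 𝒯 ∈ 𝒯) (j : J) :
    ∫⁻ v, ENNReal.ofReal ((I.myerson tie).pay v j) ∂(Measure.pi I.dist) =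
      ∫⁻ v, {v | j ∈ tie (I.maximizers v)}.indicator
        (fun v => (ironedVirtualValue (I.dist j) (v j)).toENNReal) v ∂(Measure.pi I.dist) := by
  have hφ : Measurable fun v : J → ℝ => (ironedVirtualValue (I.dist j) (v j)).toENNReal :=
    (measurable_ironedVirtualValue.comp (measurable_pi_apply j)).ereal_toENNReal
  -- By independence it suffices to integrate over coordinate `j` with the others fixed.
  refine lintegral_eq_of_lmarginal_eq {j} (measurable_myerson_pay htie j).ennreal_ofReal
    (hφ.indicator (measurableSet_served tie j)) ?_
  rw [lmarginal_singleton, lmarginal_singleton]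
  funext x
  set W := {z : ℝ | j ∈ tie (I.maximizers (Function.update x j z))} with hW
  have hWm : MeasurableSet W := measurable_update x (measurableSet_served tie j)
  have h1 : ∀ z, ENNReal.ofReal ((I.myerson tie).pay (Function.update x j z) j) =
      W.indicator (fun _ => ENNReal.ofReal (sInf W)) z := by
    intro z
    rw [myerson_pay_eq htie]
    simp only [Function.update_idem]
    by_cases hz : z ∈ W
    · rw [Set.indicator_of_mem hz, if_pos (show j ∈ tie _ from hz)]
    · rw [Set.indicator_of_notMem hz, if_neg (show j ∉ tie _ from hz), ENNReal.ofReal_zero]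
  have h2 : ∀ z, {v | j ∈ tie (I.maximizers v)}.indicator
      (fun v => (ironedVirtualValue (I.dist j) (v j)).toENNReal) (Function.update x j z) =
      W.indicator (fun z => (ironedVirtualValue (I.dist j) z).toENNReal) z := by
    intro z
    by_cases hz : z ∈ W
    · rw [Set.indicator_of_mem hz, Set.indicator_of_mem (s := {v | j ∈ tie (I.maximizers v)}) hz,
        Function.update_self]
    · rw [Set.indicator_of_notMem hz,
        Set.indicator_of_notMem (s := {v | j ∈ tie (I.maximizers v)}) hz]
  simp_rw [h1, h2]
  rw [lintegral_indicator_const hWm, lintegral_indicator hWm]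
  rcases W.eq_empty_or_nonempty with hne | hne
  · simp [hne]
  have hup : ∀ z ∈ W, ∀ z', z ≤ z' → z' ∈ W :=
    fun z hz z' hzz => mem_tie_maximizers_mono htie x hzz hz
  have hnonneg : ∀ z ∈ W, 0 ≤ ironedVirtualValue (I.dist j) z := by
    intro z hz
    simpa using ironedVirtualValue_nonneg_of_served htie hz
  have hpos : ∀ z ∈ W, 0 ≤ z := by
    intro z hz
    simpa using (bid_pos_of_served htie hz).le
  refine le_antisymm (sInf_mul_measure_le hne hpos hup)
    (lintegral_le_sInf_mul_measure hne hup (fun z hz z' h => ?_) hnonneg)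
  change j ∈ tie (I.maximizers _)
  rwa [I.maximizers_update_congr x h]

end BSMD

/-! ### Pointwise comparison of virtual surpluses. -/

theorem sum_toENNReal_of_nonneg {ι : Type*} (s : Finset ι) (f : ι → EReal)
    (h : ∀ i ∈ s, 0 ≤ f i) : ∑ i ∈ s, (f i).toENNReal = (∑ i ∈ s, f i).toENNReal := by
  classical
  induction s using Finset.induction_on with
  | empty => simp
  | insert i s hi ih =>
    rw [Finset.sum_insert hi, Finset.sum_insert hi, ih fun k hk => h k (Finset.mem_insert_of_mem hk),
      EReal.toENNReal_add (h i (Finset.mem_insert_self i s))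
        (Finset.sum_nonneg fun k hk => h k (Finset.mem_insert_of_mem hk))]

/-- No feasible set has a larger sum of positive parts of ironed virtual values than a set of
maximum ironed virtual surplus. -/
theorem BSMD.sum_ironedVirtualValue_le {J : Type*} (I : BSMD J) {v : J → ℝ}
    {S T : Finset J} (hS : S ∈ I.maximizers v) (hT : T ∈ I.feasible) :
    ∑ j ∈ T, (ironedVirtualValue (I.dist j) (v j)).toENNReal ≤
      ∑ j ∈ S, (ironedVirtualValue (I.dist j) (v j)).toENNReal := by
  classical
  set φ : J → EReal := fun j => ironedVirtualValue (I.dist j) (v j)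
  have h1 : ∑ j ∈ T, (φ j).toENNReal = ∑ j ∈ T with 0 ≤ φ j, (φ j).toENNReal := by
    refine (Finset.sum_subset (Finset.filter_subset _ _) fun j hj hj' => ?_).symm
    refine EReal.toENNReal_of_nonpos ?_
    by_contra! h
    exact hj' (Finset.mem_filter.2 ⟨hj, h.le⟩)
  change ∑ j ∈ T, (φ j).toENNReal ≤ ∑ j ∈ S, (φ j).toENNReal
  rw [h1, sum_toENNReal_of_nonneg _ _ fun j hj => (Finset.mem_filter.1 hj).2,
    sum_toENNReal_of_nonneg S φ fun j hj => I.ironedVirtualValue_nonneg_of_mem hS hj]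
  -- Discarding the negative members of `T` leaves a feasible set, by downward closure.
  exact EReal.toENNReal_le_toENNReal
    (hS.2 _ (I.downwardClosed T hT _ (Finset.filter_subset _ _)))

theorem ae_pi_nonneg {J : Type*} [Fintype J] (μ : J → Measure ℝ)
    [∀ j, ValueDistribution (μ j)] : ∀ᵐ v ∂(Measure.pi μ), 0 ≤ v := by
  have h : ∀ j, ∀ᵐ v ∂(Measure.pi μ), 0 ≤ v j := by
    intro j
    have h1 : ∀ᵐ z ∂(μ j), 0 ≤ z := by
      rw [ae_iff]
      convert ValueDistribution.nonneg (μ := μ j) using 2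
      ext z; simp
    exact Measure.tendsto_eval_ae_ae.eventually h1
  exact ae_all_iff.2 h

/-! ### Truthful mechanisms for unit-demand agents. -/

namespace Mechanism

variable {J N : Type*} {I : BMUMD J N} {A : Mechanism J N}

theorem update_eq_update_of_owner_ne [DecidableEq J] {v : J → ℝ} {j : J} {z z' : ℝ} (k : J)
    (hk : I.owner k ≠ I.owner j) :
    Function.update v j z k = Function.update v j z' k := by
  have : k ≠ j := by rintro rfl; exact hk rfl
  simp [Function.update_of_ne this]

variable [DecidableEq N]

theorem utility_of_mem (hfeas : A.IsFeasible I) {v w : J → ℝ} (hw : 0 ≤ w) {j : J}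
    (hj : j ∈ A.alloc w) : A.utility I (I.owner j) v w = v j - A.pay w (I.owner j) := by
  have h : {k ∈ A.alloc w | I.owner k = I.owner j} = {j} := by
    ext k
    rw [Finset.mem_filter, Finset.mem_singleton]
    constructor
    · exact fun hk => I.unitDemand _ (hfeas w hw) k hk.1 j hj hk.2
    · rintro rfl
      exact ⟨hj, rfl⟩
  rw [utility, h, Finset.sum_singleton]

/-- Charges each agent's payment to a service allocated to her; agents without a service pay
nothing. Positive parts are subadditive. -/
theorem ofReal_revenue_le [Fintype J] [Fintype N] (hIR : A.IsIndividuallyRational I) {v : J → ℝ}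
    (hv : 0 ≤ v) : ENNReal.ofReal (A.revenue v) ≤
      ∑ j, {v | 0 ≤ v ∧ j ∈ A.alloc v}.indicator
        (fun v => ENNReal.ofReal (A.pay v (I.owner j))) v := by
  rw [← Finset.sum_fiberwise Finset.univ I.owner]
  refine (Finset.le_sum_of_subadditive ENNReal.ofReal (by simp)
    (fun _ _ => ENNReal.ofReal_add_le) _ _).trans (Finset.sum_le_sum fun i _ => ?_)
  by_cases h : ∃ j ∈ A.alloc v, I.owner j = i
  · obtain ⟨j, hj, rfl⟩ := h
    have hmem : v ∈ {v : J → ℝ | 0 ≤ v ∧ j ∈ A.alloc v} := ⟨hv, hj⟩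
    refine le_trans (le_of_eq ?_) (Finset.single_le_sum (f := fun j =>
      {v | 0 ≤ v ∧ j ∈ A.alloc v}.indicator (fun v => ENNReal.ofReal (A.pay v (I.owner j))) v)
      (fun _ _ => zero_le) (Finset.mem_filter.2 ⟨Finset.mem_univ j, rfl⟩))
    rw [Set.indicator_of_mem hmem]
  · push Not at h
    rw [(hIR v hv i).2 h]
    simp

variable [DecidableEq J]

/-- The payment for a service does not exceed any bid on this service that wins it, given the
other bids. -/
theorem pay_update_le (hfeas : A.IsFeasible I) (hIR : A.IsIndividuallyRational I)
    (htruthful : A.IsTruthful I) {v : J → ℝ} {j : J} {z z' : ℝ}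
    (hz : 0 ≤ Function.update v j z) (hz' : 0 ≤ Function.update v j z')
    (hj : j ∈ A.alloc (Function.update v j z)) (hj' : j ∈ A.alloc (Function.update v j z')) :
    A.pay (Function.update v j z) (I.owner j) ≤ z' := by
  -- With either bid the agent wins `j`, so truthfulness compares the payments only; the payment at
  -- `z'` is at most `z'` by individual rationality.
  have h := htruthful (I.owner j) _ _ hz hz' fun k hk => update_eq_update_of_owner_ne k hk
  rw [utility_of_mem hfeas hz' hj', utility_of_mem hfeas hz hj] at h
  have h2 := (hIR _ hz' (I.owner j)).1 j hj' rfl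
  rw [Function.update_self] at h2
  linarith

/-- A bid on a service that wins it can be raised. -/
theorem mem_alloc_update_mono (hfeas : A.IsFeasible I) (htruthful : A.IsTruthful I)
    {v : J → ℝ} {j : J} {z z' : ℝ}
    (hz : 0 ≤ Function.update v j z) (hzz : z ≤ z')
    (hj : j ∈ A.alloc (Function.update v j z)) : j ∈ A.alloc (Function.update v j z') := by
  rcases hzz.eq_or_lt with rfl | hlt
  · exact hj
  have hz' : 0 ≤ Function.update v j z' := hz.trans (update_le_update_iff.2
    ⟨hzz, fun _ _ => le_rfl⟩)
  by_contra hj'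
  have h1 := htruthful (I.owner j) _ _ hz hz' fun k hk => update_eq_update_of_owner_ne k hk
  have h2 := htruthful (I.owner j) _ _ hz' hz fun k hk => update_eq_update_of_owner_ne k hk
  -- An outcome without `j` is worth the same at both values, while winning `j` at the old payment
  -- gains `z' - z`; both truthfulness constraints cannot then hold.
  have h3 : A.utility I (I.owner j) (Function.update v j z) (Function.update v j z') =
      A.utility I (I.owner j) (Function.update v j z') (Function.update v j z') := by
    unfold utility
    congr 1
    refine Finset.sum_congr rfl fun k hk => ?_
    have : k ≠ j := by
      rintro rfl
      exact hj' (Finset.mem_filter.1 hk).1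
    simp [Function.update_of_ne this]
  rw [utility_of_mem hfeas hz hj, Function.update_self] at h1 h2
  linarith

/-- The expected payment for a service is at most the expected contribution of the service to the
ironed virtual surplus. -/
theorem lintegral_pay_le [Fintype J] [∀ j, ValueDistribution (I.dist j)] (hmeas : A.IsMeasurable)
    (hfeas : A.IsFeasible I) (hIR : A.IsIndividuallyRational I) (htruthful : A.IsTruthful I)
    (j : J) :
    ∫⁻ v, {v | 0 ≤ v ∧ j ∈ A.alloc v}.indicator
        (fun v => ENNReal.ofReal (A.pay v (I.owner j))) v ∂(Measure.pi I.dist) ≤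
      ∫⁻ v, {v | 0 ≤ v ∧ j ∈ A.alloc v}.indicator
        (fun v => (ironedVirtualValue (I.dist j) (v j)).toENNReal) v ∂(Measure.pi I.dist) := by
  have hφ : Measurable fun v : J → ℝ => (ironedVirtualValue (I.dist j) (v j)).toENNReal :=
    (measurable_ironedVirtualValue.comp (measurable_pi_apply j)).ereal_toENNReal
  have hE : MeasurableSet {v : J → ℝ | 0 ≤ v ∧ j ∈ A.alloc v} :=
    (measurableSet_le measurable_const measurable_id).inter (hmeas.1 j)
  refine lintegral_le_of_lmarginal_le {j} ((hmeas.2 (I.owner j)).ennreal_ofReal.indicator hE)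
    (hφ.indicator hE) ?_
  rw [lmarginal_singleton, lmarginal_singleton]
  intro x
  set W := {z : ℝ | 0 ≤ Function.update x j z ∧ j ∈ A.alloc (Function.update x j z)} with hW
  have hWm : MeasurableSet W := measurable_update x hE
  have h1 : ∀ z, {v | 0 ≤ v ∧ j ∈ A.alloc v}.indicator
      (fun v => ENNReal.ofReal (A.pay v (I.owner j))) (Function.update x j z) ≤
      W.indicator (fun _ => ENNReal.ofReal (sInf W)) z := by
    intro z
    by_cases hz : z ∈ W
    · rw [Set.indicator_of_mem hz,
        Set.indicator_of_mem (s := {v | 0 ≤ v ∧ j ∈ A.alloc v}) hz]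
      exact ENNReal.ofReal_le_ofReal (le_csInf ⟨z, hz⟩ fun z' hz' =>
        pay_update_le hfeas hIR htruthful hz.1 hz'.1 hz.2 hz'.2)
    · rw [Set.indicator_of_notMem (s := {v | 0 ≤ v ∧ j ∈ A.alloc v}) hz]
      exact zero_le
  have h2 : ∀ z, {v | 0 ≤ v ∧ j ∈ A.alloc v}.indicator
      (fun v => (ironedVirtualValue (I.dist j) (v j)).toENNReal) (Function.update x j z) =
      W.indicator (fun z => (ironedVirtualValue (I.dist j) z).toENNReal) z := by
    intro z
    by_cases hz : z ∈ W
    · rw [Set.indicator_of_mem hz, Set.indicator_of_mem (s := {v | 0 ≤ v ∧ j ∈ A.alloc v}) hz,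
        Function.update_self]
    · rw [Set.indicator_of_notMem hz,
        Set.indicator_of_notMem (s := {v | 0 ≤ v ∧ j ∈ A.alloc v}) hz]
  refine (lintegral_mono h1).trans ?_
  simp_rw [h2]
  rw [lintegral_indicator_const hWm, lintegral_indicator hWm]
  rcases W.eq_empty_or_nonempty with hne | hne
  · simp [hne]
  refine sInf_mul_measure_le hne (fun z hz => ?_) fun z hz z' hzz => ?_
  · simpa using hz.1 j
  · exact ⟨hz.1.trans (update_le_update_iff.2 ⟨hzz, fun _ _ => le_rfl⟩),
      mem_alloc_update_mono hfeas htruthful hz.1 hzz hz.2⟩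

/-- The expected revenue of a truthful mechanism is at most that of Myerson's mechanism for the
instance with copies. -/
theorem lintegral_revenue_le [Fintype J] [Fintype N] [∀ j, ValueDistribution (I.dist j)]
    (hmeas : A.IsMeasurable) (hfeas : A.IsFeasible I) (hIR : A.IsIndividuallyRational I)
    (htruthful : A.IsTruthful I) {tie : Set (Finset J) → Finset J}
    (htie : ∀ 𝒯 : Set (Finset J), 𝒯.Nonempty → tie 𝒯 ∈ 𝒯) :
    ∫⁻ v, ENNReal.ofReal (A.revenue v) ∂(Measure.pi I.dist) ≤
      ∫⁻ v, ENNReal.ofReal ((I.copies.myerson tie).revenue v) ∂(Measure.pi I.dist) := by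
  have : ∀ j, ValueDistribution (I.copies.dist j) := ‹_›
  have hφ : ∀ j, Measurable fun v : J → ℝ => (ironedVirtualValue (I.dist j) (v j)).toENNReal :=
    fun j => (measurable_ironedVirtualValue.comp (measurable_pi_apply j)).ereal_toENNReal
  have hE : ∀ j, MeasurableSet {v : J → ℝ | 0 ≤ v ∧ j ∈ A.alloc v} := fun j =>
    (measurableSet_le measurable_const measurable_id).inter (hmeas.1 j)
  have hM : ∀ v, ENNReal.ofReal ((I.copies.myerson tie).revenue v) =
      ∑ j, ENNReal.ofReal ((I.copies.myerson tie).pay v j) := fun v =>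
    ENNReal.ofReal_sum_of_nonneg fun j _ => I.copies.myerson_pay_nonneg tie v j
  calc ∫⁻ v, ENNReal.ofReal (A.revenue v) ∂(Measure.pi I.dist)
      ≤ ∫⁻ v, ∑ j, {v | 0 ≤ v ∧ j ∈ A.alloc v}.indicator
          (fun v => ENNReal.ofReal (A.pay v (I.owner j))) v ∂(Measure.pi I.dist) :=
        lintegral_mono_ae ((ae_pi_nonneg I.dist).mono fun v hv => ofReal_revenue_le hIR hv)
    _ = ∑ j, ∫⁻ v, {v | 0 ≤ v ∧ j ∈ A.alloc v}.indicator
          (fun v => ENNReal.ofReal (A.pay v (I.owner j))) v ∂(Measure.pi I.dist) :=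
        lintegral_finsetSum _ fun j _ => (hmeas.2 (I.owner j)).ennreal_ofReal.indicator (hE j)
    _ ≤ ∑ j, ∫⁻ v, {v | 0 ≤ v ∧ j ∈ A.alloc v}.indicator
          (fun v => (ironedVirtualValue (I.dist j) (v j)).toENNReal) v ∂(Measure.pi I.dist) :=
        Finset.sum_le_sum fun j _ => lintegral_pay_le hmeas hfeas hIR htruthful j
    _ = ∫⁻ v, ∑ j, {v | 0 ≤ v ∧ j ∈ A.alloc v}.indicator
          (fun v => (ironedVirtualValue (I.dist j) (v j)).toENNReal) v ∂(Measure.pi I.dist) :=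
        (lintegral_finsetSum _ fun j _ => (hφ j).indicator (hE j)).symm
    _ ≤ ∫⁻ v, ∑ j, {v | j ∈ tie (I.copies.maximizers v)}.indicator
          (fun v => (ironedVirtualValue (I.dist j) (v j)).toENNReal) v ∂(Measure.pi I.dist) := by
        -- The two allocations meet only here: the set chosen by `A` competes with Myerson's set at
        -- the same `v`.
        refine lintegral_mono_ae ((ae_pi_nonneg I.dist).mono fun v hv => ?_)
        have := I.copies.sum_ironedVirtualValue_le (BSMD.tie_mem_maximizers htie v) (hfeas v hv)
        have h1 : ∀ j, {v | 0 ≤ v ∧ j ∈ A.alloc v}.indicator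
            (fun v => (ironedVirtualValue (I.dist j) (v j)).toENNReal) v =
            if j ∈ A.alloc v then (ironedVirtualValue (I.dist j) (v j)).toENNReal else 0 :=
          fun j => by
            classical
            exact (Set.indicator_apply _ _ _).trans (if_congr (and_iff_right hv) rfl rfl)
        have h2 : ∀ j, {v | j ∈ tie (I.copies.maximizers v)}.indicator
            (fun v => (ironedVirtualValue (I.dist j) (v j)).toENNReal) v =
            if j ∈ tie (I.copies.maximizers v) then
              (ironedVirtualValue (I.dist j) (v j)).toENNReal else 0 :=
          fun j => Set.indicator_apply _ _ _
        simp_rw [h1, h2]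
        rw [Finset.sum_ite_mem, Finset.sum_ite_mem, Finset.univ_inter, Finset.univ_inter]
        exact this
    _ = ∑ j, ∫⁻ v, {v | j ∈ tie (I.copies.maximizers v)}.indicator
          (fun v => (ironedVirtualValue (I.dist j) (v j)).toENNReal) v ∂(Measure.pi I.dist) :=
        lintegral_finsetSum _ fun j _ => (hφ j).indicator (BSMD.measurableSet_served tie j)
    _ = ∑ j, ∫⁻ v, ENNReal.ofReal ((I.copies.myerson tie).pay v j) ∂(Measure.pi I.dist) :=
        Finset.sum_congr rfl fun j _ => (BSMD.lintegral_myerson_pay (I := I.copies) htie j).symm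
    _ = ∫⁻ v, ∑ j, ENNReal.ofReal ((I.copies.myerson tie).pay v j) ∂(Measure.pi I.dist) :=
        (lintegral_finsetSum _ fun j _ =>
          (BSMD.measurable_myerson_pay htie j).ennreal_ofReal).symm
    _ = _ := lintegral_congr fun v => (hM v).symm

end Mechanism

/-! ### Integrability and conclusion. -/

theorem BSMD.integrable_myerson_revenue {J : Type*} [Fintype J] [DecidableEq J] {I : BSMD J}
    [∀ j, ValueDistribution (I.dist j)] {tie : Set (Finset J) → Finset J}
    (htie : ∀ 𝒯 : Set (Finset J), 𝒯.Nonempty → tie 𝒯 ∈ 𝒯) :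
    Integrable (I.myerson tie).revenue (Measure.pi I.dist) := by
  refine integrable_finsetSum _ fun j _ => ?_
  refine ⟨(measurable_myerson_pay htie j).aestronglyMeasurable, ?_⟩
  rw [hasFiniteIntegral_iff_ofReal (Eventually.of_forall fun v => I.myerson_pay_nonneg tie v j),
    lintegral_myerson_pay htie j]
  calc _ ≤ ∫⁻ v, (ironedVirtualValue (I.dist j) (v j)).toENNReal ∂(Measure.pi I.dist) :=
        lintegral_mono fun v => Set.indicator_le_self _ _ v
    _ = ∫⁻ z, (ironedVirtualValue (I.dist j) z).toENNReal ∂(I.dist j) :=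
        (measurePreserving_eval I.dist j).lintegral_comp
          measurable_ironedVirtualValue.ereal_toENNReal
    _ < ⊤ := lintegral_ironedVirtualValue_lt_top

theorem mainTheorem5 {J N : Type*} [Fintype J] [Fintype N] [DecidableEq J] [DecidableEq N]
    (I : BMUMD J N)
    (htail : ∀ j, Tendsto (fun p : ℝ => p * saleProb (I.dist j) p) atTop (𝓝 0))
    (A : Mechanism J N) (hmeas : A.IsMeasurable) (hfeas : A.IsFeasible I)
    (hIR : A.IsIndividuallyRational I) (htruthful : A.IsTruthful I)
    (tie : Set (Finset J) → Finset J) (htie : ∀ 𝒯 : Set (Finset J), 𝒯.Nonempty → tie 𝒯 ∈ 𝒯) :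
    Integrable (I.copies.myerson tie).revenue (Measure.pi I.dist) ∧
    ∫⁻ v, ENNReal.ofReal (A.revenue v) ∂(Measure.pi I.dist) < ⊤ ∧
    ∫ v, A.revenue v ∂(Measure.pi I.dist) ≤
      ∫ v, (I.copies.myerson tie).revenue v ∂(Measure.pi I.dist) := by
  have hdist : ∀ j, ValueDistribution (I.dist j) := fun j =>
    { toIsProbabilityMeasure := I.isProbabilityMeasure j
      toNullSingletonClass := ⟨fun x => I.hasDensity j (measure_singleton x)⟩
      nonneg := I.nonneg j
      tail := htail j }
  have : ∀ j, ValueDistribution (I.copies.dist j) := hdist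
  have hint : Integrable (I.copies.myerson tie).revenue (Measure.pi I.dist) :=
    BSMD.integrable_myerson_revenue (I := I.copies) htie
  have hnonneg : ∀ v, 0 ≤ (I.copies.myerson tie).revenue v := fun v =>
    Finset.sum_nonneg fun j _ => I.copies.myerson_pay_nonneg tie v j
  have hfin : ∫⁻ v, ENNReal.ofReal ((I.copies.myerson tie).revenue v) ∂(Measure.pi I.dist) < ⊤ :=
    (hasFiniteIntegral_iff_ofReal (Eventually.of_forall hnonneg)).1 hint.2
  have hle := Mechanism.lintegral_revenue_le hmeas hfeas hIR htruthful htie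
  refine ⟨hint, hle.trans_lt hfin, ?_⟩
  rw [integral_eq_lintegral_of_nonneg_ae (Eventually.of_forall hnonneg) hint.1]
  -- Payments of `A` may be negative with infinite expectation. The Bochner integral is then `0` by
  -- convention, and the bound holds because Myerson's revenue is nonnegative.
  by_cases hA : Integrable A.revenue (Measure.pi I.dist)
  · rw [integral_eq_lintegral_pos_part_sub_lintegral_neg_part hA]
    exact (sub_le_self _ ENNReal.toReal_nonneg).trans (ENNReal.toReal_mono hfin.ne hle)
  · rw [integral_undef hA]
    exact ENNReal.toReal_nonneg
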